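/- Let $C$ be a set of constant symbols, let $\mathcal L_{\rm ring}(C)$ be the language of rings $\{+,-,\cdot,0,1\}$ extended by the constant symbols in $C$, and let $\Sigma$ be an $\mathcal L_{\rm ring}(C)$-theory containing the axioms of fields. An existential formula is one built up from quantifier-free formulas using $\wedge,\vee,\exists$; a positive existential formula is one built up from atomic formulas, $\bot$ and $\top$ using $\wedge,\vee,\exists$. For a theory $T\supseteq\Sigma$ and an $\mathcal L_{\rm ring}(C)$-formula $\varphi$ in the free variables $X_1,\dots,X_n$, let ${\rm rk}^{\exists}_T(\varphi)$ (respectively ${\rm rk}^{\exists^+}_T(\varphi)$) be the infimum in $\mathbb N_0\cup\{\infty\}$ of all $m$ such that $\varphi$ is equivalent modulo $T$ to an existential (respectively positive existential) $\mathcal L_{\rm ring}(C)$-formula in the same free variables with $m$ quantifiers. For a model $K$ of $\Sigma$ and $\underline x\in K^n$, let $K_C(\underline x)$ be the subfield of $K$ generated by the interpretations of the constants $c\in C$ and by $x_1,\dots,x_n$. For an existential formula $\varphi(X_1,\dots,X_n)$, the essential fibre dimension ${\rm efd}_\Sigma(\varphi)$ is the smallest $d\in\mathbb N_0$ such that for every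 $K\models\Sigma$ and every $\underline x\in K^n$ with $K\models\varphi(\underline x)$ there is an intermediate field $K_C(\underline x)\subseteq K'\subseteq K$ with ${\rm trdeg}(K'/K_C(\underline x))\le d$ such that $L\models\varphi(\rho(x_1),\dots,\rho(x_n))$ for every $L\models\Sigma$ and every $\mathcal L_{\rm ring}(C)$-embedding $\rho\colon K'\to L$. For integers $n,m\ge1$ let $\pi_n^{m}$ be the formula $\exists Y_1,\dots,Y_n\bigwedge_{i=1}^n X_i= Y_i^{m}$, and for a prime $p$ let $\Sigma_p=\Sigma\cup\{p= 0\}$. **Theorem.** Suppose that ${\rm rk}^{\exists}_{\Sigma_p}(\pi_n^{p^m})\le 1$ for every prime number $p$ and all integers $n,m\ge 1$. Then for every existential $\mathcal L_{\rm ring}(C)$-formula $\varphi$ the essential fibre dimension ${\rm efd}_\Sigma(\varphi)$ exists (is finite), and $$ {\rm efd}_\Sigma(\varphi)=\max\{{\rm rk}^{\exists^+}_\Sigma(\varphi)-1,\,0\}. $$ -/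

import Mathlib

open FirstOrder FirstOrder.Language FirstOrder.Ring

noncomputable section

namespace ExistentialRank

/-! ### Existential formulas, counted by their quantifiers, and existential ranks -/

section General

universe u v w

variable {L : FirstOrder.Language.{u, v}} {α : Type w}

/-- `IsExistentialWith m φ`: the formula `φ` is built up from quantifier-free formulas
using `∧`, `∨` and `∃`, with exactly `m` occurrences of `∃`. -/
inductive IsExistentialWith : ∀ {k : ℕ}, ℕ → L.BoundedFormula α k → Prop
  | qf {k : ℕ} {φ : L.BoundedFormula α k} (h : φ.IsQF) : IsExistentialWith 0 φ
  | inf {k m₁ m₂ : ℕ} {φ ψ : L.BoundedFormula α k} (h₁ : IsExistentialWith m₁ φ)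
      (h₂ : IsExistentialWith m₂ ψ) : IsExistentialWith (m₁ + m₂) (φ ⊓ ψ)
  | sup {k m₁ m₂ : ℕ} {φ ψ : L.BoundedFormula α k} (h₁ : IsExistentialWith m₁ φ)
      (h₂ : IsExistentialWith m₂ ψ) : IsExistentialWith (m₁ + m₂) (φ ⊔ ψ)
  | ex {k m : ℕ} {φ : L.BoundedFormula α (k + 1)} (h : IsExistentialWith m φ) :
      IsExistentialWith (m + 1) φ.ex

/-- `IsPosExistentialWith m φ`: the formula `φ` is built up from atomic formulas, `⊥` and `⊤`
(the empty disjunction and conjunction) using `∧`, `∨` and `∃`,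
with exactly `m` occurrences of `∃`. -/
inductive IsPosExistentialWith : ∀ {k : ℕ}, ℕ → L.BoundedFormula α k → Prop
  | atomic {k : ℕ} {φ : L.BoundedFormula α k} (h : φ.IsAtomic) : IsPosExistentialWith 0 φ
  | bot {k : ℕ} : IsPosExistentialWith 0 (⊥ : L.BoundedFormula α k)
  | top {k : ℕ} : IsPosExistentialWith 0 (⊤ : L.BoundedFormula α k)
  | inf {k m₁ m₂ : ℕ} {φ ψ : L.BoundedFormula α k} (h₁ : IsPosExistentialWith m₁ φ)
      (h₂ : IsPosExistentialWith m₂ ψ) : IsPosExistentialWith (m₁ + m₂) (φ ⊓ ψ)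
  | sup {k m₁ m₂ : ℕ} {φ ψ : L.BoundedFormula α k} (h₁ : IsPosExistentialWith m₁ φ)
      (h₂ : IsPosExistentialWith m₂ ψ) : IsPosExistentialWith (m₁ + m₂) (φ ⊔ ψ)
  | ex {k m : ℕ} {φ : L.BoundedFormula α (k + 1)} (h : IsPosExistentialWith m φ) :
      IsPosExistentialWith (m + 1) φ.ex

/-- An existential formula: built up from quantifier-free formulas using `∧`, `∨`, `∃`. -/
def IsExistentialFormula (φ : L.Formula α) : Prop :=
  ∃ m : ℕ, IsExistentialWith m φ

/-- The existential rank of `φ` with respect to `T`: the infimum in `ℕ ∪ {∞}` of all `m` such that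
`φ` is equivalent modulo `T` to an existential formula with `m` quantifiers. -/
def existentialRank (T : L.Theory) (φ : L.Formula α) : ℕ∞ :=
  ⨅ (m : ℕ) (_ : ∃ ψ : L.Formula α, IsExistentialWith m ψ ∧ T.Iff φ ψ), (m : ℕ∞)

/-- The positive-existential rank of `φ` with respect to `T`: the infimum in `ℕ ∪ {∞}` of all `m`
such that `φ` is equivalent modulo `T` to a positive existential formula with `m` quantifiers. -/
def posExistentialRank (T : L.Theory) (φ : L.Formula α) : ℕ∞ :=
  ⨅ (m : ℕ) (_ : ∃ ψ : L.Formula α, IsPosExistentialWith m ψ ∧ T.Iff φ ψ), (m : ℕ∞)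

end General

/-! ### The language of rings with constants, theories of fields, tuples of powers -/

section Fields

universe u

/-- The language of rings extended by constant symbols for the elements of `C`. -/
abbrev ringLang (C : Type u) : FirstOrder.Language := Language.ring[[C]]

/-- The theory of fields, as a theory in the language of rings with constants from `C`
(no axioms about the constants). -/
def fieldsTheory (C : Type u) : (ringLang C).Theory :=
  (Language.ring.lhomWithConstants C).onTheory Theory.field

/-- `T` together with the axiom `p = 0`. -/
def withChar {C : Type u} (T : (ringLang C).Theory) (p : ℕ) : (ringLang C).Theory :=
  T ∪ {(Language.ring.lhomWithConstants C).onSentence (Field.eqZero p)}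

/-- The `m`-th power of a term in the language of rings. -/
def powTerm {α : Type} (t : Language.ring.Term α) : ℕ → Language.ring.Term α
  | 0 => 1
  | m + 1 => powTerm t m * t

/-- The formula `∃ Y₁, …, Yₙ, ⋀ᵢ Xᵢ = Yᵢ ^ m` in the free variables `X₁, …, Xₙ`,
in the language of rings. -/
def powersFormulaRing (n m : ℕ) : Language.ring.Formula (Fin n) :=
  (BoundedFormula.iInf fun i : Fin n =>
    (Term.var (Sum.inl i) : Language.ring.Term (Fin n ⊕ Fin n)).bdEqual
      (powTerm (Term.var (Sum.inr i)) m)).exs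

/-- The same formula, in the language of rings with constants from `C`. -/
def powersFormula (C : Type u) (n m : ℕ) : (ringLang C).Formula (Fin n) :=
  (Language.ring.lhomWithConstants C).onFormula (powersFormulaRing n m)

/-! ### Essential fibre dimension

A model of a theory of fields in the language of rings with constants from `C` is given by a field
`K`, the compatible `Language.ring`-structure on it, and an interpretation of the constants. -/

/-- The interpretation in `K` of the constant symbol `c`. -/
def constVal {C : Type u} (K : Type u) [Field K] [CompatibleRing K]
    [(constantsOn C).Structure K] (c : C) : K :=
  (Language.ring.con c : (ringLang C).Constants)

/-- The subfield `K_C(x₁, …, xₙ)` of `K` generated by the interpretations of the constants and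
by `x₁, …, xₙ`. -/
def baseField (C : Type u) (K : Type u) [Field K] [CompatibleRing K] [(constantsOn C).Structure K]
    {n : ℕ} (x : Fin n → K) : Subfield K :=
  Subfield.closure (Set.range (constVal (C := C) K) ∪ Set.range x)

/-- The interpretation of the constant symbol `c`, as an element of `K_C(x₁, …, xₙ)`. -/
def baseField.const {C : Type u} {K : Type u} [Field K] [CompatibleRing K] [(constantsOn C).Structure K]
    {n : ℕ} (x : Fin n → K) (c : C) : baseField C K x :=
  ⟨constVal K c, Subfield.subset_closure (Or.inl ⟨c, rfl⟩)⟩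

/-- The element `xᵢ` of `K_C(x₁, …, xₙ)`. -/
def baseField.elem {C : Type u} {K : Type u} [Field K] [CompatibleRing K] [(constantsOn C).Structure K]
    {n : ℕ} (x : Fin n → K) (i : Fin n) : baseField C K x :=
  ⟨x i, Subfield.subset_closure (Or.inr ⟨i, rfl⟩)⟩

/-- For every model `K` of `T` and every `x` in `K` with `K ⊨ φ(x)`, there is a subextension
`K' / K_C(x)` of `K / K_C(x)` of transcendence degree at most `d` such that `M ⊨ φ(ρ(x))` for every
model `M` of `T` and every embedding `ρ : K' → M` of structures in the language of rings with
constants, i.e. every ring homomorphism (automatically injective) compatible with the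
interpretations of the constants. -/
def HasFibreDimLE {C : Type u} (T : (ringLang C).Theory) {n : ℕ}
    (φ : (ringLang C).Formula (Fin n)) (d : ℕ) : Prop :=
  ∀ (K : Type u) [Field K] [CompatibleRing K] [(constantsOn C).Structure K], T.Model K →
    ∀ x : Fin n → K, φ.Realize x →
      ∃ K' : IntermediateField (baseField C K x) K,
        Algebra.trdeg (baseField C K x) K' ≤ (d : Cardinal) ∧
        ∀ (M : Type u) [Field M] [CompatibleRing M] [(constantsOn C).Structure M], T.Model M →
          ∀ ρ : K' →+* M,
            (∀ c : C, ρ (algebraMap (baseField C K x) K' (baseField.const x c)) = constVal M c) →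
            φ.Realize fun i => ρ (algebraMap (baseField C K x) K' (baseField.elem x i))

/-- The essential fibre dimension of `φ` with respect to `T`: the smallest `d` such that
`HasFibreDimLE T φ d` (and `∞` if there is none). -/
def essFibreDim {C : Type u} (T : (ringLang C).Theory) {n : ℕ}
    (φ : (ringLang C).Formula (Fin n)) : ℕ∞ :=
  ⨅ (d : ℕ) (_ : HasFibreDimLE T φ d), (d : ℕ∞)

end Fields

end ExistentialRank

end

/-! The link between both sides is the notion `Forces`: a set B forces φ(x) if φ survives every ring
homomorphism to a model of T that respects the constants and is defined on a subring of K containing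
B and x. By compactness, finitely many elements of B already suffice, and if every instance of φ is
forced by at most d elements, then φ has a positive existential definition with d quantifiers
(`exists_isPosExistentialWith_iff`).

Fibre dimension ≤ rank - 1 (`hasFibreDimLE_of_iff_isPosExistentialWith`): let s be a set of at most
m witnesses for a positive formula at x, and k the field generated by the constants and x. If s is
algebraically dependent over k, then k(s) has transcendence degree at most m - 1. If it is
independent, k itself is enough: an embedding of k extends to the polynomial ring k[s] by sending s
to 0, and positive formulas tolerate the lack of injectivity.

Rank ≤ fibre dimension + 1 (`Forces.exists_finset_card_le`): a field K' of transcendence degree at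
most d forces φ(x), hence so does a finite S ⊆ K'. Let t ⊆ S be a transcendence basis, and F = k(t).
If S lies in a simple extension F(v), finitely many elements of F(v) again suffice, and one element
v' generates them as a ring together with t, x and the constants
(`exists_forall_mem_closure_insert`); so d + 1 elements force φ(x). In characteristic 0 the element
v is primitive. In characteristic p, S is replaced by its p^m-th powers, which are separable over F;
the hypothesis on powers supplies a single algebraic z ensuring that their images are again p^m-th
powers (`exists_isAlgebraic_forall_pow`), and a primitive element exists because only z may be
inseparable.

Finiteness: the witnesses of an existential formula generate an extension of bounded transcendence
degree (`IsExistentialWith.hasFibreDimLE`). -/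

noncomputable section

namespace ExistentialRank

/-! ### Compactness -/

section Compactness

universe u v w

/-- Compactness for consequences of a set of formulas in the same free variables. -/
theorem exists_finset_realize_imp {L : FirstOrder.Language.{u, v}} {α : Type w} (T : L.Theory)
    (Δ : Set (L.Formula α)) (φ : L.Formula α)
    (h : ∀ (M : Type max u v w) [L.Structure M] [Nonempty M], T.Model M → ∀ v : α → M,
      (∀ δ ∈ Δ, δ.Realize v) → φ.Realize v) :
    ∃ Δ₀ : Finset (L.Formula α), (∀ δ ∈ Δ₀, δ ∈ Δ) ∧
      ∀ (M : Type max u v w) [L.Structure M] [Nonempty M], T.Model M → ∀ v : α → M,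
        (∀ δ ∈ Δ₀, δ.Realize v) → φ.Realize v := by
  classical
  -- Turning the free variables into new constants reduces the claim to compactness for sentences.
  have key : ((L.lhomWithConstants α).onTheory T ∪ Formula.equivSentence '' Δ) ⊨ᵇ
      Formula.equivSentence φ := by
    refine Theory.models_sentence_iff.2 fun M => ?_
    let := (L.lhomWithConstants α).reduct M
    have hM := M.is_model
    rw [Theory.model_union_iff, LHom.onTheory_model] at hM
    rw [Formula.realize_equivSentence]
    refine h M hM.1 _ fun δ hδ => ?_
    rw [← Formula.realize_equivSentence]
    exact hM.2.realize_of_mem _ ⟨δ, hδ, rfl⟩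
  obtain ⟨T₀, hT₀, hφ⟩ := Theory.models_iff_finset_models.1 key
  refine ⟨(T₀.image Formula.equivSentence.symm).filter (· ∈ Δ),
    fun δ hδ => (Finset.mem_filter.1 hδ).2, fun M _ _ hM v hv => ?_⟩
  let : (constantsOn α).Structure M := constantsOn.structure v
  have : M ⊨ (T₀ : L[[α]].Theory) := by
    refine (Theory.model_iff _).2 fun θ hθ => ?_
    rcases hT₀ hθ with hθ' | ⟨δ, hδ, rfl⟩
    · exact ((LHom.onTheory_model _ _).2 hM).realize_of_mem _ hθ'
    · rw [Formula.realize_equivSentence]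
      exact hv δ (Finset.mem_filter.2 ⟨Finset.mem_image.2 ⟨_, hθ, by simp⟩, hδ⟩)
  exact (Formula.realize_equivSentence _ _).1 (hφ.realize_sentence M)

/-- Every model of a theory of fields arises from a field, its compatible structure and an
interpretation of the constants. -/
theorem exists_field_of_model {C : Type u} {T : (ringLang C).Theory} (hT : fieldsTheory C ⊆ T)
    (M : Type w) [S : (ringLang C).Structure M] (hM : T.Model M) :
    ∃ (_ : Field M) (_ : CompatibleRing M) (_ : (constantsOn C).Structure M),
      S = Language.withConstantsStructure Language.ring C := by
  let R : Language.ring.Structure M := (Language.ring.lhomWithConstants C).reduct M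
  let R' : (constantsOn C).Structure M :=
    @LHom.reduct _ (ringLang C) LHom.sumInr M S
  have : M ⊨ Theory.field := by
    rw [← LHom.onTheory_model (Language.ring.lhomWithConstants C)]
    exact hM.mono hT
  refine ⟨FirstOrder.Field.fieldOfModelField M, FirstOrder.Field.compatibleRingOfModelField M, R',
    ?_⟩
  ext n f x
  · cases f <;> rfl
  · cases f <;> rfl

/-- Compactness for theories of fields. -/
theorem exists_finset_realize_imp_of_field {C : Type u} {T : (ringLang C).Theory}
    (hT : fieldsTheory C ⊆ T) {α : Type w}
    (Δ : Set ((ringLang C).Formula α)) (φ : (ringLang C).Formula α)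
    (h : ∀ (M : Type max u w) [Field M] [CompatibleRing M] [(constantsOn C).Structure M],
      T.Model M → ∀ v : α → M, (∀ δ ∈ Δ, δ.Realize v) → φ.Realize v) :
    ∃ Δ₀ : Finset ((ringLang C).Formula α), (∀ δ ∈ Δ₀, δ ∈ Δ) ∧
      ∀ (M : Type max u w) [Field M] [CompatibleRing M] [(constantsOn C).Structure M],
        T.Model M → ∀ v : α → M, (∀ δ ∈ Δ₀, δ.Realize v) → φ.Realize v := by
  obtain ⟨Δ₀, h₀, h₁⟩ := exists_finset_realize_imp T Δ φ fun M _ _ hM v hv => by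
    obtain ⟨_, _, _, rfl⟩ := exists_field_of_model hT M hM
    exact h M hM v hv
  exact ⟨Δ₀, h₀, fun M _ _ _ hM => h₁ M hM⟩

theorem iff_of_forall_field {C : Type u} {T : (ringLang C).Theory}
    (hT : fieldsTheory C ⊆ T) {α : Type w} (φ ψ : (ringLang C).Formula α)
    (h : ∀ (M : Type max u w) [Field M] [CompatibleRing M] [(constantsOn C).Structure M],
      T.Model M → ∀ v : α → M, φ.Realize v ↔ ψ.Realize v) : T.Iff φ ψ := by
  refine Theory.models_formula_iff.2 fun M v => ?_
  have hM := M.is_model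
  rcases M with ⟨M⟩
  obtain ⟨_, _, _, rfl⟩ := exists_field_of_model hT M hM
  exact BoundedFormula.realize_iff.2 (h M hM v)

end Compactness

/-! ### Partial homomorphisms, as subrings of a product -/

section PartialHom

universe u

variable {C : Type u} {K M : Type u} [Field K] [CompatibleRing K] [(constantsOn C).Structure K]
  [Field M] [CompatibleRing M] [(constantsOn C).Structure M] {α : Type*}

variable (C) in
/-- The subring `W` of `K × M` is the graph of a ring homomorphism from a subring of `K` to `M`
that is compatible with the interpretations of the constants. -/
structure IsPartialHom (W : Subring (K × M)) : Prop where
  const : ∀ c : C, (constVal K c, constVal M c) ∈ W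
  unique : ∀ y : M, (0, y) ∈ W → y = 0

theorem IsPartialHom.eq {W : Subring (K × M)} (hW : IsPartialHom C W) {x : K} {y y' : M}
    (h : (x, y) ∈ W) (h' : (x, y') ∈ W) : y = y' := by
  refine sub_eq_zero.1 (hW.unique _ ?_)
  simpa using W.sub_mem h h'

variable (C) in
theorem funMap_inl_add (x : Fin 2 → K) :
    Structure.funMap (L := ringLang C) (Sum.inl addFunc) x = x 0 + x 1 :=
  CompatibleRing.funMap_add x

variable (C) in
theorem funMap_inl_mul (x : Fin 2 → K) :
    Structure.funMap (L := ringLang C) (Sum.inl mulFunc) x = x 0 * x 1 :=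
  CompatibleRing.funMap_mul x

variable (C) in
theorem funMap_inl_neg (x : Fin 1 → K) :
    Structure.funMap (L := ringLang C) (Sum.inl negFunc) x = -x 0 :=
  CompatibleRing.funMap_neg x

variable (C) in
theorem funMap_inl_zero (x : Fin 0 → K) :
    Structure.funMap (L := ringLang C) (Sum.inl zeroFunc) x = 0 :=
  CompatibleRing.funMap_zero x

variable (C) in
theorem funMap_inl_one (x : Fin 0 → K) :
    Structure.funMap (L := ringLang C) (Sum.inl oneFunc) x = 1 :=
  CompatibleRing.funMap_one x

theorem funMap_inr (c : (constantsOn C).Functions 0) (x : Fin 0 → K) :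
    Structure.funMap (L := ringLang C) (Sum.inr c) x = constVal (C := C) K c := by
  rw [Subsingleton.elim x default]
  rfl

theorem realize_mem [DecidableEq α] {W : Subring (K × M)}
    (hW : ∀ c : C, (constVal K c, constVal M c) ∈ W) {a : α → K} {b : α → M}
    (t : (ringLang C).Term α) (h : ∀ i ∈ t.varFinset, (a i, b i) ∈ W) :
    (t.realize a, t.realize b) ∈ W := by
  induction t with
  | var i => exact h i (by simp)
  | @func l f ts ih =>
    replace ih := fun i => ih i fun j hj =>
      h j (by simpa [Term.varFinset] using ⟨i, hj⟩)
    rw [Term.realize, Term.realize]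
    rcases f with f | f
    · cases f with
      | add =>
        erw [funMap_inl_add C, funMap_inl_add C]
        exact W.add_mem (ih 0) (ih 1)
      | mul =>
        erw [funMap_inl_mul C, funMap_inl_mul C]
        exact W.mul_mem (ih 0) (ih 1)
      | neg =>
        erw [funMap_inl_neg C, funMap_inl_neg C]
        exact W.neg_mem (ih 0)
      | zero =>
        erw [funMap_inl_zero C, funMap_inl_zero C]
        exact W.zero_mem
      | one =>
        erw [funMap_inl_one C, funMap_inl_one C]
        exact W.one_mem
    · cases l with
      | zero =>
        erw [funMap_inr, funMap_inr]
        exact hW f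
      | succ l => exact isEmptyElim f

/-- The subring of `K × M` generated by the constants and a tuple of pairs consists of the pairs
of values of terms. -/
theorem exists_term_of_mem_closure {a : α → K} {b : α → M} {p : K × M}
    (hp : p ∈ Subring.closure (Set.range (fun c : C => (constVal K c, constVal M c)) ∪
      Set.range fun i => (a i, b i))) :
    ∃ t : (ringLang C).Term α, t.realize a = p.1 ∧ t.realize b = p.2 := by
  induction hp using Subring.closure_induction with
  | mem p hp =>
    rcases hp with ⟨c, rfl⟩ | ⟨i, rfl⟩
    · exact ⟨Constants.term (Language.ring.con c), by simp [constVal], by simp [constVal]⟩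
    · exact ⟨Term.var i, rfl, rfl⟩
  | zero => exact ⟨.func (Sum.inl zeroFunc) ![], funMap_inl_zero C _, funMap_inl_zero C _⟩
  | one => exact ⟨.func (Sum.inl oneFunc) ![], funMap_inl_one C _, funMap_inl_one C _⟩
  | add p q _ _ hp hq =>
    obtain ⟨t, ht, ht'⟩ := hp
    obtain ⟨r, hr, hr'⟩ := hq
    exact ⟨.func (Sum.inl addFunc) ![t, r], (funMap_inl_add C _).trans (by simp [ht, hr]),
      (funMap_inl_add C _).trans (by simp [ht', hr'])⟩
  | mul p q _ _ hp hq =>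
    obtain ⟨t, ht, ht'⟩ := hp
    obtain ⟨r, hr, hr'⟩ := hq
    exact ⟨.func (Sum.inl mulFunc) ![t, r], (funMap_inl_mul C _).trans (by simp [ht, hr]),
      (funMap_inl_mul C _).trans (by simp [ht', hr'])⟩
  | neg p _ hp =>
    obtain ⟨t, ht, ht'⟩ := hp
    exact ⟨.func (Sum.inl negFunc) ![t], (funMap_inl_neg C _).trans (by simp [ht]),
      (funMap_inl_neg C _).trans (by simp [ht'])⟩

end PartialHom

/-! ### Transfer of existential formulas along partial homomorphisms -/

section Transfer

universe u

variable {C : Type u} {K : Type u} [Field K] [CompatibleRing K] [(constantsOn C).Structure K]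
  {α : Type*} {k : ℕ}

theorem realize_sumElim_mem {M : Type u} [Field M] [CompatibleRing M] [(constantsOn C).Structure M]
    {W : Subring (K × M)} (hW : ∀ c : C, (constVal K c, constVal M c) ∈ W)
    {v : α → K} {xs : Fin k → K} {v' : α → M} {xs' : Fin k → M}
    (hv : ∀ i, (v i, v' i) ∈ W) (hxs : ∀ i, (xs i, xs' i) ∈ W)
    (t : (ringLang C).Term (α ⊕ Fin k)) :
    (t.realize (Sum.elim v xs), t.realize (Sum.elim v' xs')) ∈ W := by
  classical
  exact realize_mem hW t fun i _ => by cases i <;> simp [hv, hxs]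

theorem isEmpty_relations {l : ℕ} : IsEmpty ((ringLang C).Relations l) :=
  ⟨fun R => by rcases R with R | R <;> cases R⟩

/-- The truth value of a quantifier-free formula is preserved by those partial homomorphisms
that do not annihilate finitely many given nonzero elements. -/
theorem exists_finset_realize_iff_of_isQF {φ : (ringLang C).BoundedFormula α k} (hφ : φ.IsQF)
    (v : α → K) (xs : Fin k → K) :
    ∃ D : Finset K, 0 ∉ D ∧
      ∀ (M : Type u) [Field M] [CompatibleRing M] [(constantsOn C).Structure M]
        (W : Subring (K × M)), IsPartialHom C W → (∀ y ∈ D, (y, 0) ∉ W) →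
        ∀ (v' : α → M) (xs' : Fin k → M), (∀ i, (v i, v' i) ∈ W) → (∀ i, (xs i, xs' i) ∈ W) →
          (φ.Realize v xs ↔ φ.Realize v' xs') := by
  classical
  induction hφ with
  | falsum => exact ⟨∅, by simp, fun M _ _ _ W hW hD v' xs' hv hxs => Iff.rfl⟩
  | of_isAtomic h =>
    cases h with
    | rel R ts => exact (isEmpty_relations.false R).elim
    | equal t₁ t₂ =>
      -- Only a failing equation needs protection: the nonzero difference of its sides must not be
      -- annihilated. If the equation holds, removing 0 leaves the empty set.
      refine ⟨{t₁.realize (Sum.elim v xs) - t₂.realize (Sum.elim v xs)} \ {0}, by simp,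
        fun M _ _ _ W hW hD v' xs' hv hxs => ?_⟩
      rw [BoundedFormula.realize_bdEqual, BoundedFormula.realize_bdEqual]
      have h₁ := realize_sumElim_mem hW.const hv hxs t₁
      have h₂ := realize_sumElim_mem hW.const hv hxs t₂
      refine ⟨fun h => ?_, fun h => ?_⟩
      · rw [h] at h₁
        exact hW.eq h₁ h₂
      · by_contra hne
        refine hD (t₁.realize (Sum.elim v xs) - t₂.realize (Sum.elim v xs))
          (by simp [sub_eq_zero, hne]) ?_
        simpa [h] using W.sub_mem h₁ h₂
  | imp _ _ ih₁ ih₂ =>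
    obtain ⟨D₁, h0₁, h₁⟩ := ih₁
    obtain ⟨D₂, h0₂, h₂⟩ := ih₂
    refine ⟨D₁ ∪ D₂, by simp [h0₁, h0₂], fun M _ _ _ W hW hD v' xs' hv hxs => ?_⟩
    rw [BoundedFormula.realize_imp, BoundedFormula.realize_imp,
      h₁ M W hW (fun y hy => hD y (by simp [hy])) v' xs' hv hxs,
      h₂ M W hW (fun y hy => hD y (by simp [hy])) v' xs' hv hxs]

theorem snoc_mem {K M : Type*} [Field K] [Field M] {W : Subring (K × M)}
    {xs : Fin k → K} {xs' : Fin k → M} (hxs : ∀ i, (xs i, xs' i) ∈ W) {y : K} {y' : M} (hy : (y, y') ∈ W) (i : Fin (k + 1)) :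
    (Fin.snoc (α := fun _ => K) xs y i, Fin.snoc (α := fun _ => M) xs' y' i) ∈ W := by
  induction i using Fin.lastCases with
  | last => simpa using hy
  | cast i => simpa using hxs i

/-- An existential formula with `m` quantifiers is preserved by partial homomorphisms that are
defined on `m` suitable elements and do not annihilate finitely many given nonzero elements. -/
theorem IsExistentialWith.exists_finset {m : ℕ} {φ : (ringLang C).BoundedFormula α k}
    (hφ : IsExistentialWith m φ) {v : α → K} {xs : Fin k → K} (h : φ.Realize v xs) :
    ∃ s D : Finset K, s.card ≤ m ∧ 0 ∉ D ∧
      ∀ (M : Type u) [Field M] [CompatibleRing M] [(constantsOn C).Structure M]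
        (W : Subring (K × M)), IsPartialHom C W → (∀ y ∈ s, ∃ y', (y, y') ∈ W) →
        (∀ y ∈ D, (y, 0) ∉ W) →
        ∀ (v' : α → M) (xs' : Fin k → M), (∀ i, (v i, v' i) ∈ W) → (∀ i, (xs i, xs' i) ∈ W) →
          φ.Realize v' xs' := by
  classical
  induction hφ with
  | qf hqf =>
    obtain ⟨D, h0, hD⟩ := exists_finset_realize_iff_of_isQF hqf v xs
    exact ⟨∅, D, by simp, h0, fun M _ _ _ W hW _ hWD v' xs' hv hxs =>
      (hD M W hW hWD v' xs' hv hxs).1 h⟩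
  | inf _ _ ih₁ ih₂ =>
    rw [BoundedFormula.realize_inf] at h
    obtain ⟨s₁, D₁, c₁, z₁, h₁⟩ := ih₁ h.1
    obtain ⟨s₂, D₂, c₂, z₂, h₂⟩ := ih₂ h.2
    refine ⟨s₁ ∪ s₂, D₁ ∪ D₂, (Finset.card_union_le _ _).trans (by lia), by simp [z₁, z₂],
      fun M _ _ _ W hW hs hD v' xs' hv hxs => BoundedFormula.realize_inf.2 ⟨?_, ?_⟩⟩
    · exact h₁ M W hW (fun y hy => hs y (by simp [hy])) (fun y hy => hD y (by simp [hy])) v' xs' hv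
        hxs
    · exact h₂ M W hW (fun y hy => hs y (by simp [hy])) (fun y hy => hD y (by simp [hy])) v' xs' hv
        hxs
  | sup _ _ ih₁ ih₂ =>
    rcases BoundedFormula.realize_sup.1 h with h | h
    · obtain ⟨s, D, c, z, h⟩ := ih₁ h
      exact ⟨s, D, by lia, z, fun M _ _ _ W hW hs hD v' xs' hv hxs =>
        BoundedFormula.realize_sup.2 (Or.inl (h M W hW hs hD v' xs' hv hxs))⟩
    · obtain ⟨s, D, c, z, h⟩ := ih₂ h
      exact ⟨s, D, by lia, z, fun M _ _ _ W hW hs hD v' xs' hv hxs =>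
        BoundedFormula.realize_sup.2 (Or.inr (h M W hW hs hD v' xs' hv hxs))⟩
  | ex _ ih =>
    obtain ⟨y, hy⟩ := BoundedFormula.realize_ex.1 h
    obtain ⟨s, D, c, z, h⟩ := ih hy
    refine ⟨insert y s, D, (Finset.card_insert_le _ _).trans (by lia), z,
      fun M _ _ _ W hW hs hD v' xs' hv hxs => BoundedFormula.realize_ex.2 ?_⟩
    obtain ⟨y', hy'⟩ := hs y (by simp)
    exact ⟨y', h M W hW (fun y hy => hs y (by simp [hy])) hD v' _ hv (snoc_mem hxs hy')⟩

/-- A positive existential formula with `m` quantifiers is preserved by partial homomorphisms that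
are defined on `m` suitable elements. -/
theorem IsPosExistentialWith.exists_finset {m : ℕ} {φ : (ringLang C).BoundedFormula α k}
    (hφ : IsPosExistentialWith m φ) {v : α → K} {xs : Fin k → K} (h : φ.Realize v xs) :
    ∃ s : Finset K, s.card ≤ m ∧
      ∀ (M : Type u) [Field M] [CompatibleRing M] [(constantsOn C).Structure M]
        (W : Subring (K × M)), IsPartialHom C W → (∀ y ∈ s, ∃ y', (y, y') ∈ W) →
        ∀ (v' : α → M) (xs' : Fin k → M), (∀ i, (v i, v' i) ∈ W) → (∀ i, (xs i, xs' i) ∈ W) →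
          φ.Realize v' xs' := by
  classical
  induction hφ with
  | atomic hat =>
    refine ⟨∅, by simp, fun M _ _ _ W hW _ v' xs' hv hxs => ?_⟩
    cases hat with
    | rel R ts => exact (isEmpty_relations.false R).elim
    | equal t₁ t₂ =>
      rw [BoundedFormula.realize_bdEqual] at h ⊢
      have h₁ := realize_sumElim_mem hW.const hv hxs t₁
      rw [h] at h₁
      exact hW.eq h₁ (realize_sumElim_mem hW.const hv hxs t₂)
  | bot => exact h.elim
  | top => exact ⟨∅, by simp, fun M _ _ _ W _ _ v' xs' _ _ => BoundedFormula.realize_top.2 trivial⟩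
  | inf _ _ ih₁ ih₂ =>
    rw [BoundedFormula.realize_inf] at h
    obtain ⟨s₁, c₁, h₁⟩ := ih₁ h.1
    obtain ⟨s₂, c₂, h₂⟩ := ih₂ h.2
    refine ⟨s₁ ∪ s₂, (Finset.card_union_le _ _).trans (by lia),
      fun M _ _ _ W hW hs v' xs' hv hxs => BoundedFormula.realize_inf.2 ⟨?_, ?_⟩⟩
    · exact h₁ M W hW (fun y hy => hs y (by simp [hy])) v' xs' hv hxs
    · exact h₂ M W hW (fun y hy => hs y (by simp [hy])) v' xs' hv hxs
  | sup _ _ ih₁ ih₂ =>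
    rcases BoundedFormula.realize_sup.1 h with h | h
    · obtain ⟨s, c, h⟩ := ih₁ h
      exact ⟨s, by lia, fun M _ _ _ W hW hs v' xs' hv hxs =>
        BoundedFormula.realize_sup.2 (Or.inl (h M W hW hs v' xs' hv hxs))⟩
    · obtain ⟨s, c, h⟩ := ih₂ h
      exact ⟨s, by lia, fun M _ _ _ W hW hs v' xs' hv hxs =>
        BoundedFormula.realize_sup.2 (Or.inr (h M W hW hs v' xs' hv hxs))⟩
  | ex _ ih =>
    obtain ⟨y, hy⟩ := BoundedFormula.realize_ex.1 h
    obtain ⟨s, c, h⟩ := ih hy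
    refine ⟨insert y s, (Finset.card_insert_le _ _).trans (by lia),
      fun M _ _ _ W hW hs v' xs' hv hxs => BoundedFormula.realize_ex.2 ?_⟩
    obtain ⟨y', hy'⟩ := hs y (by simp)
    exact ⟨y', h M W hW (fun y hy => hs y (by simp [hy])) v' _ hv (snoc_mem hxs hy')⟩

end Transfer

/-! ### Sets forcing a formula -/

section Forces

universe u

variable {C : Type u}

/-- The set `B` forces `φ(x)`: whenever a partial homomorphism from `K` to a model of `T` is
defined on `B` and on `x`, the image of `x` satisfies `φ`. -/
def Forces (T : (ringLang C).Theory) {n : ℕ} (φ : (ringLang C).Formula (Fin n)) {K : Type u}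
    [Field K] [CompatibleRing K] [(constantsOn C).Structure K] (x : Fin n → K) (B : Set K) : Prop :=
  ∀ (M : Type u) [Field M] [CompatibleRing M] [(constantsOn C).Structure M], T.Model M →
    ∀ W : Subring (K × M), IsPartialHom C W → (∀ y ∈ B, ∃ y', (y, y') ∈ W) →
      ∀ x' : Fin n → M, (∀ i, (x i, x' i) ∈ W) → φ.Realize x'

variable {T : (ringLang C).Theory} {n : ℕ} {φ : (ringLang C).Formula (Fin n)} {K : Type u}
  [Field K] [CompatibleRing K] [(constantsOn C).Structure K] {x : Fin n → K} {B : Set K}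

/-- If `B` forces `φ(x)`, then finitely many equations between terms in elements of `B` and `x`
already imply `φ(x)`. -/
theorem Forces.exists_equations (hT : fieldsTheory C ⊆ T) (h : Forces T φ x B) :
    ∃ P : Finset ((ringLang C).Term (B ⊕ Fin n) × (ringLang C).Term (B ⊕ Fin n)),
      (∀ p ∈ P, p.1.realize (Sum.elim ((↑) : B → K) x) = p.2.realize (Sum.elim ((↑) : B → K) x)) ∧
      ∀ (M : Type u) [Field M] [CompatibleRing M] [(constantsOn C).Structure M], T.Model M →
        ∀ b : B ⊕ Fin n → M, (∀ p ∈ P, p.1.realize b = p.2.realize b) →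
          φ.Realize fun i => b (Sum.inr i) := by
  classical
  let a : B ⊕ Fin n → K := Sum.elim ((↑) : B → K) x
  let E : Set ((ringLang C).Term (B ⊕ Fin n) × (ringLang C).Term (B ⊕ Fin n)) :=
    {p | p.1.realize a = p.2.realize a}
  let f : (ringLang C).Term (B ⊕ Fin n) × (ringLang C).Term (B ⊕ Fin n) →
      (ringLang C).Formula (B ⊕ Fin n) := fun p => p.1.equal p.2
  obtain ⟨Δ₀, h₀, h₁⟩ := exists_finset_realize_imp_of_field hT (f '' E)
    (Formula.relabel Sum.inr φ) fun M _ _ _ hM b hb => by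
      have hb' : ∀ t₁ t₂ : (ringLang C).Term (B ⊕ Fin n),
          t₁.realize a = t₂.realize a → t₁.realize b = t₂.realize b := fun t₁ t₂ ht => by
        simpa [f, Formula.realize_equal] using hb _ ⟨(t₁, t₂), ht, rfl⟩
      rw [Formula.realize_relabel]
      -- An element (0, y) of this subring is the pair of values of one term; that term equals 0 in
      -- K, and this equation belongs to the diagram satisfied by `b`, so y = 0.
      let W : Subring (K × M) := Subring.closure
        (Set.range (fun c : C => (constVal K c, constVal M c)) ∪ Set.range fun i => (a i, b i))
      refine h M hM W ⟨fun c => Subring.subset_closure (Or.inl ⟨c, rfl⟩), fun y hy => ?_⟩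
        (fun y hy => ⟨b (Sum.inl ⟨y, hy⟩), Subring.subset_closure (Or.inr ⟨Sum.inl ⟨y, hy⟩, rfl⟩)⟩)
        _ fun i => Subring.subset_closure (Or.inr ⟨Sum.inr i, rfl⟩)
      obtain ⟨t, ht, rfl⟩ := exists_term_of_mem_closure hy
      have h0 : ∀ (N : Type u) [Field N] [CompatibleRing N] [(constantsOn C).Structure N]
          (v : B ⊕ Fin n → N), (Term.func (Sum.inl zeroFunc) ![] :
            (ringLang C).Term (B ⊕ Fin n)).realize v = 0 :=
        fun N _ _ _ v => funMap_inl_zero C _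
      rw [hb' t (.func (Sum.inl zeroFunc) ![]) (ht.trans (h0 K a).symm), h0 M b]
  have : Nonempty ((ringLang C).Term (B ⊕ Fin n)) := ⟨.func (Sum.inl zeroFunc) ![]⟩
  choose! g hg hfg using h₀
  refine ⟨Δ₀.image g, fun p hp => ?_, fun M _ _ _ hM b hb => ?_⟩
  · obtain ⟨δ, hδ, rfl⟩ := Finset.mem_image.1 hp
    exact hg δ hδ
  · refine (Formula.realize_relabel (g := Sum.inr)).1 (h₁ M hM b fun δ hδ => ?_)
    rw [← hfg δ hδ]
    exact Formula.realize_equal.2 (hb _ (Finset.mem_image_of_mem g hδ))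

/-- The finitely many equations given by compactness mention only finitely many elements of B. -/
theorem Forces.exists_finset (hT : fieldsTheory C ⊆ T) (h : Forces T φ x B) :
    ∃ S : Finset K, (∀ y ∈ S, y ∈ B) ∧ Forces T φ x S := by
  classical
  obtain ⟨P, hP, hPφ⟩ := h.exists_equations hT
  let V : Finset (B ⊕ Fin n) := P.biUnion fun p => p.1.varFinset ∪ p.2.varFinset
  refine ⟨(V.preimage Sum.inl Sum.inl_injective.injOn).image (↑), fun y hy => ?_,
    fun M _ _ _ hM W hW hS x' hx' => ?_⟩
  · obtain ⟨z, -, rfl⟩ := Finset.mem_image.1 hy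
    exact z.2
  · choose! g hg using hS
    refine hPφ M hM (Sum.elim (fun y => g y) x') fun p hp => ?_
    have key : ∀ i ∈ V, (Sum.elim ((↑) : B → K) x i, Sum.elim (fun y : B => g y) x' i) ∈ W := by
      rintro (i | i) hi
      · exact hg _ (by simpa using hi)
      · exact hx' i
    have h₁ := realize_mem hW.const p.1 fun i hi => key i
      (Finset.mem_biUnion.2 ⟨p, hp, Finset.mem_union_left _ hi⟩)
    have h₂ := realize_mem hW.const p.2 fun i hi => key i
      (Finset.mem_biUnion.2 ⟨p, hp, Finset.mem_union_right _ hi⟩)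
    rw [hP p hp] at h₁
    exact hW.eq h₁ h₂

theorem IsPosExistentialWith.exs {L : FirstOrder.Language} {α : Type*} {m d : ℕ}
    {θ : L.BoundedFormula α d} (h : IsPosExistentialWith m θ) :
    IsPosExistentialWith (m + d) θ.exs := by
  induction d generalizing m with
  | zero => exact h
  | succ d ih =>
    rw [show m + (d + 1) = m + 1 + d by lia]
    exact ih h.ex

/-- A set with at most `d` elements forcing `φ(x)` yields a positive existential formula with `d`
quantifiers which holds at `x` and implies `φ` modulo `T`. -/
theorem Forces.exists_formula (hT : fieldsTheory C ⊆ T) {s : Finset K} {d : ℕ} (hs : s.card ≤ d)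
    (h : Forces T φ x s) :
    ∃ θ : (ringLang C).BoundedFormula (Fin n) d, IsPosExistentialWith 0 θ ∧ θ.exs.Realize x ∧
      ∀ (M : Type u) [Field M] [CompatibleRing M] [(constantsOn C).Structure M], T.Model M →
        ∀ x' : Fin n → M, θ.exs.Realize x' → φ.Realize x' := by
  classical
  obtain ⟨P, hP, hPφ⟩ := h.exists_equations hT
  obtain ⟨e⟩ : Nonempty ((s : Set K) ↪ Fin d) :=
    Function.Embedding.nonempty_of_card_le (by simpa using hs)
  let g : ((s : Set K) ⊕ Fin n) → Fin n ⊕ Fin d := Sum.elim (fun y => Sum.inr (e y)) Sum.inl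
  have hconj : ∀ Q : Finset ((ringLang C).Term ((s : Set K) ⊕ Fin n) ×
      (ringLang C).Term ((s : Set K) ⊕ Fin n)),
      ∃ θ : (ringLang C).BoundedFormula (Fin n) d, IsPosExistentialWith 0 θ ∧
        ∀ (M : Type u) [Field M] [CompatibleRing M] [(constantsOn C).Structure M]
          (v : Fin n → M) (xs : Fin d → M), θ.Realize v xs ↔ ∀ p ∈ Q,
            p.1.realize (Sum.elim v xs ∘ g) = p.2.realize (Sum.elim v xs ∘ g) := by
    intro Q
    induction Q using Finset.induction_on with
    | empty => exact ⟨⊤, .top, by simp⟩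
    | insert p Q _ ih =>
      obtain ⟨θ, hθ, hθQ⟩ := ih
      refine ⟨(p.1.relabel g).bdEqual (p.2.relabel g) ⊓ θ,
        .inf (.atomic (BoundedFormula.IsAtomic.equal _ _)) hθ, fun M _ _ _ v xs => ?_⟩
      rw [BoundedFormula.realize_inf, BoundedFormula.realize_bdEqual, Term.realize_relabel,
        Term.realize_relabel, hθQ, Finset.forall_mem_insert]
  obtain ⟨θ, hθ, hθP⟩ := hconj P
  refine ⟨θ, hθ, ?_, fun M _ _ _ hM x' hx' => ?_⟩
  -- Variables not used by an element of `s` take the dummy value 0, so the number of quantifiers is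
  -- exactly d.
  · refine BoundedFormula.realize_exs.2 ⟨Function.extend e (↑) 0, (hθP K _ _).2 fun p hp => ?_⟩
    convert hP p hp using 2 <;>
    · funext i
      rcases i with i | i
      · simp [g, e.injective.extend_apply]
      · simp [g]
  · obtain ⟨xs, hxs⟩ := BoundedFormula.realize_exs.1 hx'
    exact hPφ M hM _ ((hθP M _ _).1 hxs)

/-- If each instance of `φ` is forced by a set with at most `d` elements, then `φ` is equivalent
modulo `T` to a positive existential formula with `d` quantifiers. -/
theorem exists_isPosExistentialWith_iff (hT : fieldsTheory C ⊆ T) {d : ℕ}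
    (h : ∀ (K : Type u) [Field K] [CompatibleRing K] [(constantsOn C).Structure K], T.Model K →
      ∀ x : Fin n → K, φ.Realize x → ∃ s : Finset K, s.card ≤ d ∧ Forces T φ x s) :
    ∃ ψ : (ringLang C).Formula (Fin n), IsPosExistentialWith d ψ ∧ T.Iff φ ψ := by
  classical
  let Ψ : Set ((ringLang C).BoundedFormula (Fin n) d) := {θ | IsPosExistentialWith 0 θ ∧
    ∀ (M : Type u) [Field M] [CompatibleRing M] [(constantsOn C).Structure M], T.Model M →
      ∀ x' : Fin n → M, θ.exs.Realize x' → φ.Realize x'}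
  -- Where all formulas of `Ψ` fail, φ fails too; hence φ implies a finite disjunction of them.
  obtain ⟨Δ₀, h₀, h₁⟩ := exists_finset_realize_imp_of_field.{u, 0} hT
    ((fun θ => θ.exs.not) '' Ψ) φ.not fun M _ _ _ hM x hx => by
      rw [Formula.realize_not]
      intro hφ
      obtain ⟨s, hs, hF⟩ := h M hM x hφ
      obtain ⟨θ, hθ, hθx, hθφ⟩ := hF.exists_formula hT hs
      exact (Formula.realize_not.1 (hx _ ⟨θ, ⟨hθ, hθφ⟩, rfl⟩)) hθx
  choose! g hg hfg using h₀
  -- Since ∃ commutes with ∨, the disjunction can be formed under one common block of d quantifiers,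
  -- so it adds none.
  have hdisj : ∀ Q : Finset ((ringLang C).Formula (Fin n)), (∀ δ ∈ Q, δ ∈ Δ₀) →
      ∃ θ : (ringLang C).BoundedFormula (Fin n) d, IsPosExistentialWith 0 θ ∧
        ∀ (M : Type u) [Field M] [CompatibleRing M] [(constantsOn C).Structure M]
          (v : Fin n → M) (xs : Fin d → M), θ.Realize v xs ↔ ∃ δ ∈ Q, (g δ).Realize v xs := by
    intro Q
    induction Q using Finset.induction_on with
    | empty => exact fun _ => ⟨⊥, .bot, by simp⟩
    | insert δ Q _ ih =>
      intro hQ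
      obtain ⟨θ, hθ, hθQ⟩ := ih fun δ hδ => hQ δ (Finset.mem_insert_of_mem hδ)
      refine ⟨g δ ⊔ θ, .sup (hg δ (hQ δ (Finset.mem_insert_self _ _))).1 hθ,
        fun M _ _ _ v xs => ?_⟩
      rw [BoundedFormula.realize_sup, hθQ, Finset.exists_mem_insert]
  obtain ⟨θ, hθ, hθΔ⟩ := hdisj Δ₀ fun _ => id
  refine ⟨θ.exs, by simpa using hθ.exs, iff_of_forall_field.{u, 0} hT _ _ fun M _ _ _ hM x => ?_⟩
  constructor
  · intro hφ
    by_contra hne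
    refine (Formula.realize_not.1 (h₁ M hM x fun δ hδ => ?_)) hφ
    rw [← hfg δ hδ, Formula.realize_not]
    intro hr
    obtain ⟨xs, hxs⟩ := BoundedFormula.realize_exs.1 hr
    exact hne (BoundedFormula.realize_exs.2 ⟨xs, (hθΔ M x xs).2 ⟨δ, hδ, hxs⟩⟩)
  · intro hr
    obtain ⟨xs, hxs⟩ := BoundedFormula.realize_exs.1 hr
    obtain ⟨δ, hδ, hxs⟩ := (hθΔ M x xs).1 hxs
    exact (hg δ hδ).2 M hM x (BoundedFormula.realize_exs.2 ⟨xs, hxs⟩)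

end Forces

/-! ### Partial homomorphisms and ring homomorphisms -/

section RingHoms

universe u

variable {C : Type u} {K M : Type u} [Field K] [CompatibleRing K] [(constantsOn C).Structure K]
  [Field M] [CompatibleRing M] [(constantsOn C).Structure M] {W : Subring (K × M)}

/-- The kernel condition makes f r ↦ g r well defined. The ring R can be a field, or a polynomial
ring evaluated at independent elements. -/
theorem isPartialHom_range {R : Type*} [CommRing R] (f : R →+* K) (g : R →+* M)
    (hker : ∀ r, f r = 0 → g r = 0)
    (hc : ∀ c : C, ∃ r, f r = constVal K c ∧ g r = constVal M c) :
    IsPartialHom C (f.prod g).range where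
  const c := by
    obtain ⟨r, h₁, h₂⟩ := hc c
    exact ⟨r, by simp [h₁, h₂]⟩
  unique y := by
    rintro ⟨r, hr⟩
    simp only [RingHom.prod_apply, Prod.mk.injEq] at hr
    exact hr.2.symm.trans (hker r hr.1)

theorem IsPartialHom.exists_ringHom (hW : IsPartialHom C W) {R : Type*} [CommRing R] (f : R →+* K)
    (hf : ∀ r, ∃ y, (f r, y) ∈ W) : ∃ g : R →+* M, ∀ r, (f r, g r) ∈ W := by
  choose g hg using hf
  refine ⟨⟨⟨⟨g, ?_⟩, ?_⟩, ?_, ?_⟩, hg⟩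
  · exact hW.eq (hg 1) (by rw [map_one]; exact W.one_mem)
  · exact fun r s => hW.eq (hg (r * s)) (by simpa using W.mul_mem (hg r) (hg s))
  · exact hW.eq (hg 0) (by rw [map_zero]; exact W.zero_mem)
  · exact fun r s => hW.eq (hg (r + s)) (by simpa using W.add_mem (hg r) (hg s))

theorem IsPartialHom.mono {W' : Subring (K × M)} (hW : IsPartialHom C W) (hle : W' ≤ W)
    (hc : ∀ c : C, (constVal K c, constVal M c) ∈ W') : IsPartialHom C W' :=
  ⟨hc, fun y hy => hW.unique y (hle hy)⟩

end RingHoms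

/-! ### Auxiliary results on fields -/

section Algebra

open Polynomial IntermediateField

/-- Dividing an integral equation of degree e + 1 by w ^ e expresses w as a polynomial in w⁻¹ over
A. -/
theorem mem_of_isIntegral_of_inv_mem {K : Type*} [Field K] {A B : Subring K} (hAB : A ≤ B) {w : K}
    (hw : IsIntegral A w) (hB : w⁻¹ ∈ B) : w ∈ B := by
  by_cases h0 : w = 0
  · rw [h0]
    exact B.zero_mem
  obtain ⟨p, hp, hpw⟩ := hw
  rw [hp.as_sum, eval₂_add, eval₂_X_pow, eval₂_finsetSum] at hpw
  obtain he | ⟨e, he⟩ : p.natDegree = 0 ∨ ∃ e, p.natDegree = e + 1 :=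
    (Nat.eq_zero_or_eq_succ_pred _).imp_right fun h => ⟨_, h⟩
  · simp [he] at hpw
  · rw [he] at hpw
    have hwe : w = w ^ (e + 1) * w⁻¹ ^ e := by
      rw [pow_succ, mul_right_comm, ← mul_pow, mul_inv_cancel₀ h0, one_pow, one_mul]
    rw [hwe, eq_neg_of_add_eq_zero_left hpw, neg_mul, Finset.sum_mul]
    refine B.neg_mem (B.sum_mem fun i hi => ?_)
    have hi' : i ≤ e := Nat.lt_succ_iff.1 (Finset.mem_range.1 hi)
    rw [eval₂_mul, eval₂_C, eval₂_X_pow, mul_assoc,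
      show w ^ i * w⁻¹ ^ e = w⁻¹ ^ (e - i) by
        rw [← Nat.sub_add_cancel hi', pow_add, Nat.add_sub_cancel, mul_left_comm, ← mul_pow,
          mul_inv_cancel₀ h0, one_pow, mul_one] ]
    exact B.mul_mem (hAB (p.coeff i).2) (B.pow_mem hB _)

/-- Finitely many elements of a simple algebraic extension of the field generated by a set `A` lie
in a ring generated by `A` and one further element. -/
theorem exists_forall_mem_closure_insert {K : Type*} [Field K] {A : Set K} {F : Subfield K}
    (hF : F = Subfield.closure A) {v : K} (hv : IsAlgebraic F v) (S : Finset K)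
    (hS : ∀ y ∈ S, y ∈ F⟮v⟯) : ∃ v' : K, ∀ y ∈ S, y ∈ Subring.closure (insert v' A) := by
  classical
  let A₀ := Subring.closure A
  have hA₀F : A₀ ≤ F.toSubring := Subring.closure_le.2 (hF ▸ Subfield.subset_closure)
  have hfrac : ∀ y ∈ F, ∃ b ∈ A₀, b ≠ 0 ∧ b * y ∈ A₀ := fun y hy => by
    rw [hF, Subfield.mem_closure_iff] at hy
    obtain ⟨a, ha, b, hb, rfl⟩ := hy
    by_cases h0 : b = 0
    · exact ⟨1, A₀.one_mem, one_ne_zero, by simp [h0, A₀.zero_mem]⟩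
    · exact ⟨b, hb, h0, by rwa [mul_div_cancel₀ _ h0]⟩
  obtain ⟨c, hc0, hcv⟩ : ∃ c : A₀, c ≠ 0 ∧ IsIntegral A₀ (c • v) := by
    let : Algebra A₀ F := (Subring.inclusion hA₀F).toAlgebra
    have : IsScalarTower A₀ F K := .of_algebraMap_eq fun _ => rfl
    have : Algebra.IsAlgebraic A₀ F := ⟨fun y => by
      obtain ⟨b, hb, hb0, hby⟩ := hfrac y y.2
      refine ⟨C ⟨b, hb⟩ * X - C ⟨b * y, hby⟩, fun h => hb0 ?_, ?_⟩
      · simpa using congrArg (fun q => ((q.coeff 1 : A₀) : K)) h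
      · refine Subtype.val_injective ?_
        simp only [map_sub, map_mul, aeval_X, aeval_C]
        exact sub_self _⟩
    exact (hv.restrictScalars A₀).exists_integral_multiple
  let w : K := c * v
  have hw : IsIntegral A₀ w := hcv
  have hc0' : (c : K) ≠ 0 := by simpa using hc0
  -- As v is algebraic, F(v) = F[v], so all denominators can be chosen in `A₀`; a common one for S
  -- is formed below.
  have hden : ∀ y ∈ F⟮v⟯, ∃ g ∈ A₀, g ≠ 0 ∧ g * y ∈ Subring.closure (insert w A) := by
    have hle : A₀ ≤ Subring.closure (insert w A) := Subring.closure_mono (Set.subset_insert _ _)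
    intro y hy
    rw [← mem_toSubalgebra, adjoin_simple_toSubalgebra_of_isAlgebraic hv] at hy
    induction hy using Algebra.adjoin_induction with
    | mem y hy =>
      rw [Set.mem_singleton_iff.1 hy]
      exact ⟨c, c.2, hc0', Subring.subset_closure (Set.mem_insert _ _)⟩
    | algebraMap r =>
      obtain ⟨b, hb, hb0, hby⟩ := hfrac r r.2
      exact ⟨b, hb, hb0, hle hby⟩
    | add y z _ _ hy hz =>
      obtain ⟨g, hg, hg0, hgy⟩ := hy
      obtain ⟨h, hh, hh0, hhz⟩ := hz
      refine ⟨g * h, A₀.mul_mem hg hh, mul_ne_zero hg0 hh0, ?_⟩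
      rw [show g * h * (y + z) = h * (g * y) + g * (h * z) by ring]
      exact Subring.add_mem _ (Subring.mul_mem _ (hle hh) hgy) (Subring.mul_mem _ (hle hg) hhz)
    | mul y z _ _ hy hz =>
      obtain ⟨g, hg, hg0, hgy⟩ := hy
      obtain ⟨h, hh, hh0, hhz⟩ := hz
      refine ⟨g * h, A₀.mul_mem hg hh, mul_ne_zero hg0 hh0, ?_⟩
      rw [show g * h * (y * z) = (g * y) * (h * z) by ring]
      exact Subring.mul_mem _ hgy hhz
  choose! g hg hg0 hgy using hden
  let d : K := ∏ y ∈ S, g y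
  have hd : d ∈ A₀ := A₀.prod_mem fun y hy => hg y (hS y hy)
  have hd0 : d ≠ 0 := Finset.prod_ne_zero_iff.2 fun y hy => hg0 y (hS y hy)
  have hdy : ∀ y ∈ S, d * y ∈ Subring.closure (insert w A) := fun y hy => by
    rw [show d * y = (∏ z ∈ S.erase y, g z) * (g y * y) by
      rw [← mul_assoc, Finset.prod_erase_mul _ _ hy] ]
    exact Subring.mul_mem _ (Subring.closure_mono (Set.subset_insert _ _)
      (A₀.prod_mem fun z hz => hg z (hS z (Finset.mem_of_mem_erase hz)))) (hgy y (hS y hy))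
  suffices h : ∃ v' : K, d⁻¹ ∈ Subring.closure (insert v' A) ∧
      w ∈ Subring.closure (insert v' A) by
    obtain ⟨v', h₁, h₂⟩ := h
    refine ⟨v', fun y hy => ?_⟩
    rw [← inv_mul_cancel_left₀ hd0 y]
    refine Subring.mul_mem _ h₁ (Subring.closure_le.2 ?_ (hdy y hy))
    rintro z (rfl | hz)
    · exact h₂
    · exact Subring.subset_closure (Set.mem_insert_of_mem _ hz)
  by_cases hw0 : w = 0
  · exact ⟨d⁻¹, Subring.subset_closure (Set.mem_insert _ _), hw0 ▸ Subring.zero_mem _⟩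
  -- One generator must yield both w and d⁻¹. From (dw)⁻¹ one gets w⁻¹ by multiplying with d, then w
  -- by integrality, then d⁻¹ = w(dw)⁻¹.
  · refine ⟨(d * w)⁻¹, ?_⟩
    set B := Subring.closure (insert (d * w)⁻¹ A)
    have hAB : A₀ ≤ B := Subring.closure_mono (Set.subset_insert _ _)
    have hv' : (d * w)⁻¹ ∈ B := Subring.subset_closure (Set.mem_insert _ _)
    have hwB : w ∈ B := mem_of_isIntegral_of_inv_mem hAB hw (by
      rw [show w⁻¹ = d * (d * w)⁻¹ by field_simp]
      exact B.mul_mem (hAB hd) hv')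
    refine ⟨?_, hwB⟩
    rw [show d⁻¹ = w * (d * w)⁻¹ by field_simp]
    exact B.mul_mem hwB hv'

/-! ### Primitive elements when one generator may be inseparable -/

section

variable {F E : Type*} [Field F] [Field E] [Algebra F E]

/-- A field generated by an algebraic element `α` and a separable element `β` is generated by a
single element, if the base field is infinite. -/
theorem exists_adjoin_pair_eq_of_infinite [Infinite F] {α β : E} (hα : IsIntegral F α)
    (hβs : IsSeparable F β) : ∃ γ : E, F⟮α, β⟯ = F⟮γ⟯ := by
  have hβ := hβs.isIntegral
  let f := minpoly F α
  let g := minpoly F β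
  let ιFE := algebraMap F E
  let ιEE' := algebraMap E (SplittingField (g.map ιFE))
  -- The scalar c avoids finitely many quotients of differences of roots, which makes β the only
  -- common root of f(γ - cX) and g. It is a simple root because g is separable, so their gcd is
  -- linear; being computable over F(γ), it puts β there. Separability of α plays no role.
  obtain ⟨c, hc⟩ := Field.primitive_element_inf_aux_exists_c (ιEE'.comp ιFE) (ιEE' α) (ιEE' β) f g
  let γ := α + c • β
  suffices β_in_Fγ : β ∈ F⟮γ⟯ by
    use γ
    apply le_antisymm
    · rw [adjoin_le_iff]
      have α_in_Fγ : α ∈ F⟮γ⟯ := by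
        rw [← add_sub_cancel_right α (c • β)]
        exact F⟮γ⟯.sub_mem (mem_adjoin_simple_self F γ) (F⟮γ⟯.toSubalgebra.smul_mem β_in_Fγ c)
      rintro x (rfl | rfl) <;> assumption
    · rw [adjoin_simple_le_iff]
      have α_in_Fαβ : α ∈ F⟮α, β⟯ := subset_adjoin F {α, β} (Set.mem_insert α {β})
      have β_in_Fαβ : β ∈ F⟮α, β⟯ := subset_adjoin F {α, β} (Set.mem_insert_of_mem α rfl)
      exact F⟮α, β⟯.add_mem α_in_Fαβ (F⟮α, β⟯.smul_mem β_in_Fαβ)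
  classical
  let p := EuclideanDomain.gcd ((f.map (algebraMap F F⟮γ⟯)).comp
    (C (AdjoinSimple.gen F γ) - (C ↑c : F⟮γ⟯[X]) * X)) (g.map (algebraMap F F⟮γ⟯))
  let h := EuclideanDomain.gcd ((f.map ιFE).comp (C γ - C (ιFE c) * X)) (g.map ιFE)
  have map_g_ne_zero : g.map ιFE ≠ 0 := map_ne_zero (minpoly.ne_zero hβ)
  have h_ne_zero : h ≠ 0 :=
    mt EuclideanDomain.gcd_eq_zero_iff.mp (not_and.mpr fun _ => map_g_ne_zero)
  suffices p_linear : p.map (algebraMap F⟮γ⟯ E) = C h.leadingCoeff * (X - C β) by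
    have finale : β = algebraMap F⟮γ⟯ E (-p.coeff 0 / p.coeff 1) := by
      simp [map_div₀, map_neg, ← coeff_map, ← coeff_map, p_linear,
        mul_sub, coeff_C, mul_div_cancel_left₀ β (mt leadingCoeff_eq_zero.mp h_ne_zero)]
    rw [finale]
    exact Subtype.mem (-p.coeff 0 / p.coeff 1)
  have h_sep : h.Separable := separable_gcd_right _ (.map hβs)
  have h_root : h.eval β = 0 := by
    apply eval_gcd_eq_zero
    · rw [eval_comp, eval_sub, eval_mul, eval_C, eval_C, eval_X, eval_map_algebraMap, ←
        Algebra.smul_def, add_sub_cancel_right, minpoly.aeval]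
    · rw [eval_map_algebraMap, minpoly.aeval]
  have h_splits : Splits (h.map ιEE') := by
    rw [← Polynomial.gcd_map]
    exact (SplittingField.splits _).of_dvd (map_ne_zero map_g_ne_zero)
      (EuclideanDomain.gcd_dvd_right _ _)
  have h_roots : ∀ x ∈ (h.map ιEE').roots, x = ιEE' β := by
    intro x hx
    rw [mem_roots_map h_ne_zero] at hx
    specialize hc (ιEE' γ - ιEE' (ιFE c) * x) (by
      have f_root := root_left_of_root_gcd hx
      rw [eval₂_comp, eval₂_sub, eval₂_mul, eval₂_C, eval₂_C, eval₂_X, eval₂_map] at f_root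
      exact (mem_roots_map (minpoly.ne_zero hα)).mpr f_root)
    specialize hc x (by
      rw [mem_roots_map (minpoly.ne_zero hβ), ← eval₂_map]
      exact root_right_of_root_gcd hx)
    by_contra a
    apply hc
    apply (div_eq_iff (sub_ne_zero.mpr a)).mpr
    simp only [γ, Algebra.smul_def, map_add, map_mul, RingHom.comp_apply]
    ring
  rw [← eq_X_sub_C_of_separable_of_root_eq h_sep h_root h_splits h_roots]
  trans EuclideanDomain.gcd (?_ : E[X]) (?_ : E[X])
  · dsimp only [γ]
    convert! (gcd_map (algebraMap F⟮γ⟯ E)).symm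
  · simp only [map_comp, Polynomial.map_map, ← IsScalarTower.algebraMap_eq, Polynomial.map_sub,
      map_C, AdjoinSimple.algebraMap_gen, Polynomial.map_mul, map_X]
    congr

theorem exists_adjoin_simple_eq (L : IntermediateField F E) [FiniteDimensional F L]
    [Algebra.IsSeparable F L] : ∃ w : E, IsSeparable F w ∧ L = F⟮w⟯ := by
  obtain ⟨w, hw⟩ := Field.exists_primitive_element F L
  refine ⟨w, (Algebra.IsSeparable.isSeparable F w).map L.val L.val.injective, ?_⟩
  have := congrArg (IntermediateField.map L.val) hw
  rw [adjoin_map, Set.image_singleton, ← AlgHom.fieldRange_eq_map, fieldRange_val] at this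
  exact this.symm

/-- A field generated by finitely many separable elements and one algebraic element is generated
by a single element. -/
theorem exists_adjoin_insert_le {S : Set E} (hS : S.Finite) (hsep : ∀ y ∈ S, IsSeparable F y)
    {z : E} (hz : IsAlgebraic F z) :
    ∃ v : E, IsAlgebraic F v ∧ adjoin F (insert z S) ≤ F⟮v⟯ := by
  rcases finite_or_infinite F with hF | hF
  · have hint : ∀ y ∈ insert z S, IsIntegral F y := by
      rintro y (rfl | hy)
      · exact hz.isIntegral
      · exact (hsep y hy).isIntegral
    have : Finite (insert z S : Set E) := hS.insert z
    have : FiniteDimensional F (adjoin F (insert z S)) :=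
      finiteDimensional_adjoin hint
    obtain ⟨v, hv, h⟩ := exists_adjoin_simple_eq (adjoin F (insert z S))
    exact ⟨v, hv.isIntegral.isAlgebraic, h.le⟩
  · have : Finite S := hS
    have : FiniteDimensional F (adjoin F S) :=
      finiteDimensional_adjoin fun y hy => (hsep y hy).isIntegral
    have : Algebra.IsSeparable F (adjoin F S) := (isSeparable_adjoin_iff_isSeparable F E).2 hsep
    obtain ⟨w, hw, h⟩ := exists_adjoin_simple_eq (adjoin F S)
    obtain ⟨v, hv⟩ := exists_adjoin_pair_eq_of_infinite hz.isIntegral hw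
    have hwv : w ∈ F⟮z, w⟯ := subset_adjoin _ _ (by simp)
    refine ⟨v, ?_, adjoin_le_iff.2 ?_⟩
    · have : FiniteDimensional F F⟮z, w⟯ := finiteDimensional_adjoin (by
        rintro y (rfl | rfl)
        exacts [hz.isIntegral, hw.isIntegral])
      have hv' : v ∈ F⟮z, w⟯ := hv ▸ mem_adjoin_simple_self F v
      exact (Algebra.IsAlgebraic.isAlgebraic (R := F) (⟨v, hv'⟩ : F⟮z, w⟯)).algHom
        (F⟮z, w⟯).val
    · rw [← hv]
      rintro y (rfl | hy)
      · exact subset_adjoin _ _ (by simp)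
      · exact (adjoin_simple_le_iff.2 hwv) (h ▸ subset_adjoin F S hy)

end

end Algebra

/-! ### Tuples of powers -/

section Powers

universe u

open Polynomial IntermediateField

variable {C : Type u}

theorem realize_powTerm {K : Type*} [Field K] [CompatibleRing K] {α : Type}
    (t : Language.ring.Term α) (m : ℕ) (v : α → K) : (powTerm t m).realize v = t.realize v ^ m := by
  induction m with
  | zero => simp [powTerm]
  | succ m ih => simp [powTerm, ih, pow_succ]

theorem realize_powersFormula {K : Type u} [Field K] [CompatibleRing K]
    [(constantsOn C).Structure K] {n m : ℕ} {x : Fin n → K} :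
    (powersFormula C n m).Realize x ↔ ∀ i, ∃ y, x i = y ^ m := by
  rw [powersFormula, LHom.realize_onFormula, powersFormulaRing, BoundedFormula.realize_exs]
  simp only [BoundedFormula.realize_iInf, BoundedFormula.realize_bdEqual, realize_powTerm,
    Term.realize_var, Sum.elim_inl, Sum.elim_inr]
  exact (Classical.skolem (p := fun i y => x i = y ^ m)).symm

theorem model_withChar_iff {T : (ringLang C).Theory} {p : ℕ} {K : Type u} [Field K]
    [CompatibleRing K] [(constantsOn C).Structure K] :
    (withChar T p).Model K ↔ T.Model K ∧ (p : K) = 0 := by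
  rw [withChar, Theory.model_union_iff, Theory.model_singleton_iff, LHom.realize_onSentence]
  exact and_congr_right fun _ => FirstOrder.Field.realize_eqZero p default

theorem exists_of_existentialRank_le {L : FirstOrder.Language} {α : Type*} {T : L.Theory}
    {φ : L.Formula α} {d : ℕ} (h : existentialRank T φ ≤ d) :
    ∃ m ≤ d, ∃ ψ : L.Formula α, IsExistentialWith m ψ ∧ T.Iff φ ψ := by
  have h' := h.trans_lt (ENat.natCast_lt_natCast.2 d.lt_succ_self)
  simp only [existentialRank, iInf_lt_iff] at h'
  obtain ⟨m, hm, hlt⟩ := h'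
  exact ⟨m, Nat.lt_succ_iff.1 (ENat.natCast_lt_natCast.1 hlt), hm⟩

variable {K M : Type u} [Field K] [CompatibleRing K] [(constantsOn C).Structure K]
  [Field M] [CompatibleRing M] [(constantsOn C).Structure M] {W : Subring (K × M)}

theorem IsPartialHom.natCast_eq_zero (hW : IsPartialHom C W) {p : ℕ} (hp : (p : K) = 0) :
    (p : M) = 0 :=
  hW.unique _ (by
    rw [← hp]
    exact natCast_mem W p)

/-- A partial homomorphism defined on a subfield restricts to an injective one. -/
theorem IsPartialHom.exists_restrict (hW : IsPartialHom C W) (N : Subfield K)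
    (hN : ∀ y ∈ N, ∃ y', (y, y') ∈ W) (hc : ∀ c : C, constVal K c ∈ N) :
    ∃ W' : Subring (K × M), IsPartialHom C W' ∧
      (∀ y y', (y, y') ∈ W' ↔ (y, y') ∈ W ∧ y ∈ N) ∧ ∀ y, (y, 0) ∈ W' → y = 0 := by
  have hmem : ∀ y y', (y, y') ∈ W ⊓ N.toSubring.comap (RingHom.fst K M) ↔ (y, y') ∈ W ∧ y ∈ N :=
    fun y y' => Iff.rfl
  refine ⟨W ⊓ N.toSubring.comap (RingHom.fst K M),
    hW.mono inf_le_left fun c => (hmem _ _).2 ⟨hW.const c, hc c⟩, hmem, fun y hy => ?_⟩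
  -- If y ≠ 0 were sent to 0, multiplying by the image of y⁻¹ would give 1 ↦ 0.
  by_contra h0
  obtain ⟨z, hz⟩ := hN y⁻¹ (N.inv_mem hy.2)
  have h1 : ((1 : K), (0 : M)) ∈ W := by
    simpa [mul_inv_cancel₀ h0] using W.mul_mem hy.1 hz
  exact one_ne_zero (hW.eq W.one_mem h1)

/-- If being a tuple of `p ^ m`-th powers has existential rank at most `1`, then for every tuple
`β` of `p ^ m`-th powers in `K` that are algebraic over a subfield `F`, there is `z` algebraic over
`F` such that homomorphisms defined on `F(z, β)` map `β` to a tuple of `p ^ m`-th powers. -/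
theorem exists_isAlgebraic_forall_pow {T : (ringLang C).Theory} {p : ℕ} (hp : p.Prime) {n m : ℕ}
    (hrank : existentialRank (withChar T p) (powersFormula C n (p ^ m)) ≤ 1)
    (hK : T.Model K) (hpK : (p : K) = 0) (F : Subfield K) (hF : ∀ c : C, constVal K c ∈ F)
    (β : Fin n → K) (hβ : ∀ i, IsAlgebraic F (β i)) (hpow : ∀ i, ∃ y, β i = y ^ p ^ m) :
    ∃ z : K, IsAlgebraic F z ∧
      ∀ (M : Type u) [Field M] [CompatibleRing M] [(constantsOn C).Structure M], T.Model M →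
        ∀ W : Subring (K × M), IsPartialHom C W →
          (∀ y ∈ adjoin F (insert z (Set.range β)), ∃ y', (y, y') ∈ W) →
          ∀ β' : Fin n → M, (∀ i, (β i, β' i) ∈ W) → ∀ i, ∃ y, β' i = y ^ p ^ m := by
  classical
  obtain ⟨m', hm', ψ, hψ, hiff⟩ := exists_of_existentialRank_le (d := 1) (by exact_mod_cast hrank)
  have hreal : ∀ (M : Type u) [Field M] [CompatibleRing M] [(constantsOn C).Structure M],
      T.Model M → (p : M) = 0 → ∀ β' : Fin n → M, ψ.Realize β' ↔ ∀ i, ∃ y, β' i = y ^ p ^ m :=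
    fun M _ _ _ hM hpM β' => by
      have := model_withChar_iff.2 ⟨hM, hpM⟩
      rw [← realize_powersFormula (C := C)]
      exact (hiff.realize_iff).symm
  obtain ⟨s, D, hs, hD0, hsD⟩ := hψ.exists_finset ((hreal K hK hpK β).2 hpow)
  obtain ⟨z₀, hz₀⟩ := Finset.card_le_one_iff_subset_singleton.1 (hs.trans hm')
  have hFc : ∀ (c : C) (L : IntermediateField F K), constVal K c ∈ L := fun c L =>
    L.algebraMap_mem ⟨_, hF c⟩
  -- An algebraic witness can serve as z. A transcendental one need not be in the domain: its image
  -- can be chosen freely, subject to finitely many inequations.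
  by_cases halg : IsAlgebraic F z₀
  · refine ⟨z₀, halg, fun M _ _ _ hM W hW hN β' hβ' => ?_⟩
    obtain ⟨W', hW', hmem, hinj⟩ := hW.exists_restrict
      (adjoin F (insert z₀ (Set.range β))).toSubfield hN (hFc · _)
    refine (hreal M hM (hW.natCast_eq_zero hpK) β').1 (hsD M W' hW' (fun y hy => ?_)
      (fun y hy hy0 => hD0 (hinj y hy0 ▸ hy)) β' _ (fun i => (hmem _ _).2 ⟨hβ' i, ?_⟩)
      fun i => i.elim0)
    · obtain rfl := Finset.mem_singleton.1 (hz₀ hy)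
      have hy' : y ∈ adjoin F (insert y (Set.range β)) := subset_adjoin _ _ (by simp)
      obtain ⟨y', hyy'⟩ := hN y hy'
      exact ⟨y', (hmem _ _).2 ⟨hyy', hy'⟩⟩
    · exact subset_adjoin _ _ (by simp)
  · refine ⟨0, isAlgebraic_zero, fun M _ _ _ hM W hW hN β' hβ' => ?_⟩
    have hpM := hW.natCast_eq_zero hpK
    have : Fact p.Prime := ⟨hp⟩
    have : CharP M p := (CharP.charP_iff_prime_eq_zero hp).2 hpM
    -- Over a finite M there may be no room to avoid roots, but there Frobenius is bijective and
    -- every element is a p^m-th power.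
    rcases finite_or_infinite M with hfin | hinf
    · intro i
      obtain ⟨y, hy⟩ := (bijective_iterateFrobenius M p m).2 (β' i)
      exact ⟨y, by rw [← hy, iterateFrobenius_def]⟩
    let L := adjoin F (insert 0 (Set.range β))
    have hβL : ∀ i, β i ∈ L := fun i => subset_adjoin _ _ (by simp)
    have : Algebra.IsAlgebraic F L := isAlgebraic_adjoin (by
      rintro y (rfl | ⟨i, rfl⟩)
      exacts [isIntegral_zero, (hβ i).isIntegral])
    have htr : Transcendental L z₀ := fun h => halg (h.restrictScalars F)
    obtain ⟨ρ, hρ⟩ := hW.exists_ringHom (algebraMap L K) fun y => hN y y.2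
    let f : L[X] →+* K := (aeval z₀ : L[X] →ₐ[L] K).toRingHom
    have hf : Function.Injective f := transcendental_iff_injective.1 htr
    -- A non-root of q keeps the elements of `D` in L[z₀] from being annihilated; other elements of
    -- `D` are outside the new domain.
    let q : M[X] := ∏ g ∈ D.preimage f hf.injOn, g.map ρ
    have hq : q ≠ 0 := Finset.prod_ne_zero_iff.2 fun g hg => by
      rw [Ne, Polynomial.map_eq_zero]
      rintro rfl
      exact hD0 (by simpa using hg)
    obtain ⟨z', hz'⟩ : ∃ z', q.eval z' ≠ 0 := by
      by_contra! h
      exact hq (Polynomial.funext (by simpa using h))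
    let g : L[X] →+* M := eval₂RingHom ρ z'
    have hW₂ : IsPartialHom C (f.prod g).range :=
      isPartialHom_range f g (fun r hr => by rw [(map_eq_zero_iff f hf).1 hr, map_zero])
        fun c => ⟨.C ⟨constVal K c, hFc c L⟩, by simp [f],
          by simpa [g] using hW.eq (hρ ⟨constVal K c, hFc c L⟩) (hW.const c)⟩
    refine (hreal M hM hpM β').1 (hsD M _ hW₂ (fun y hy => ?_) (fun y hy hy0 => ?_) β' _
      (fun i => ?_) fun i => i.elim0)
    · obtain rfl := Finset.mem_singleton.1 (hz₀ hy)
      exact ⟨z', X, by simp [f, g]⟩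
    · obtain ⟨r, hr⟩ := hy0
      simp only [RingHom.prod_apply, Prod.mk.injEq] at hr
      refine hz' ?_
      rw [eval_prod]
      refine Finset.prod_eq_zero (i := r) (by simpa [hr.1] using hy) ?_
      rw [eval_map]
      exact hr.2
    · refine ⟨.C ⟨β i, hβL i⟩, ?_⟩
      simpa [f, g] using hW.eq (hρ ⟨β i, hβL i⟩) (hβ' i)

end Powers

/-! ### Forcing by few elements -/

section FewElements

universe u

open Polynomial IntermediateField

theorem exists_isSeparable_pow {F E : Type*} [Field F] [Field E] [Algebra F E] (q : ℕ) [ExpChar F q]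
    {S : Finset E} (hS : ∀ y ∈ S, IsAlgebraic F y) :
    ∃ m, 1 ≤ m ∧ ∀ y ∈ S, IsSeparable F (y ^ q ^ m) := by
  have key : ∀ y ∈ S, ∃ m, IsSeparable F (y ^ q ^ m) := fun y hy => by
    obtain ⟨g, hg, m, hm⟩ := (minpoly.irreducible (hS y hy).isIntegral).hasSeparableContraction q
    refine ⟨m, hg.of_dvd (minpoly.dvd F _ ?_)⟩
    rw [← expand_aeval, hm, minpoly.aeval]
  choose! f hf using key
  -- The summand 1 secures m ≥ 1, which the hypothesis on powers requires.
  refine ⟨S.sup f + 1, by lia, fun y hy => ?_⟩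
  obtain ⟨j, hj⟩ := Nat.exists_eq_add_of_le ((Finset.le_sup hy).trans (Nat.le_succ (S.sup f)))
  rw [← mem_separableClosure_iff, Nat.succ_eq_add_one] at *
  rw [hj, pow_add, pow_mul]
  exact pow_mem (mem_separableClosure_iff.2 (hf y hy)) _

/-- A transcendence basis t is taken inside S itself; its elements lie in K' and are independent, so
the transcendence degree of K' bounds their number. -/
theorem exists_subset_isAlgebraic_card_le {K : Type u} [Field K] {k : Subfield K}
    (K' : IntermediateField k K) {d : ℕ} (hd : Algebra.trdeg k K' ≤ d) (S : Finset K)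
    (hS : ∀ y ∈ S, y ∈ K') :
    ∃ t : Finset K, t.card ≤ d ∧
      ∀ y ∈ S, IsAlgebraic (Subfield.closure ((k : Set K) ∪ t)) y := by
  classical
  obtain ⟨t, ht⟩ := (AlgebraicIndependent.matroid k K).exists_isBasis (S : Set K)
  rw [AlgebraicIndependent.matroid_isBasis_iff] at ht
  obtain ⟨hind, htS, halg⟩ := ht
  lift t to Finset K using S.finite_toSet.subset htS
  refine ⟨t, ?_, fun y hy => ?_⟩
  · have h' : AlgebraicIndependent k (fun y : (t : Set K) => (⟨y, hS y (htS y.2)⟩ : K')) :=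
      AlgebraicIndependent.of_comp K'.val hind
    have := h'.cardinalMk_le_trdeg.trans hd
    simpa using this
  · set F := Subfield.closure ((k : Set K) ∪ t)
    have hle : ∀ a ∈ Algebra.adjoin k (t : Set K), a ∈ F := fun a ha => by
      induction ha using Algebra.adjoin_induction with
      | mem a ha => exact Subfield.subset_closure (Or.inr ha)
      | algebraMap r => exact Subfield.subset_closure (Or.inl r.2)
      | add a b _ _ ha hb => exact F.add_mem ha hb
      | mul a b _ _ ha hb => exact F.mul_mem ha hb
    let ι : Algebra.adjoin k (t : Set K) →+* F :=
      (algebraMap (Algebra.adjoin k (t : Set K)) K).codRestrict F fun a => hle a a.2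
    let : Algebra (Algebra.adjoin k (t : Set K)) F := ι.toAlgebra
    have : IsScalarTower (Algebra.adjoin k (t : Set K)) F K := .of_algebraMap_eq fun _ => rfl
    have hinj : Function.Injective (algebraMap (Algebra.adjoin k (t : Set K)) F) := fun a b h =>
      Subtype.val_injective (congrArg (Subtype.val : F → K) h)
    exact (halg y hy).extendScalars hinj

variable {C : Type u} {T : (ringLang C).Theory} {n : ℕ} {φ : (ringLang C).Formula (Fin n)}
  {K : Type u} [Field K] [CompatibleRing K] [(constantsOn C).Structure K] {x : Fin n → K}

theorem Forces.mono {A B : Set K} (h : Forces T φ x A) (hAB : A ⊆ B) : Forces T φ x B :=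
  fun M _ _ _ hM W hW hB => h M hM W hW fun y hy => hB y (hAB hy)

/-- The domain of a partial homomorphism is a subring containing the constants, so being defined on
generators is enough. -/
theorem Forces.of_subset_closure {A B : Set K} (h : Forces T φ x A)
    (hAB : A ⊆ Subring.closure (B ∪ (Set.range (constVal (C := C) K) ∪ Set.range x))) :
    Forces T φ x B := fun M _ _ _ hM W hW hB x' hx' => by
  refine h M hM W hW (fun y hy => ?_) x' hx'
  have hle : Subring.closure (B ∪ (Set.range (constVal (C := C) K) ∪ Set.range x)) ≤
      W.map (RingHom.fst K M) := Subring.closure_le.2 (by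
    rintro y (hy | ⟨c, rfl⟩ | ⟨i, rfl⟩)
    · obtain ⟨y', hy'⟩ := hB y hy
      exact ⟨_, hy', rfl⟩
    · exact ⟨_, hW.const c, rfl⟩
    · exact ⟨_, hx' i, rfl⟩)
  obtain ⟨⟨_, y'⟩, hy', rfl⟩ := hle (hAB hy)
  exact ⟨y', hy'⟩

/-- If `S` forces `φ(x)`, then so does any set containing the `Q`-th powers of the elements of `S`
such that the homomorphisms defined on it map these powers to `Q`-th powers, provided that taking
`Q`-th powers is a homomorphism. -/
theorem Forces.of_pow {S B : Set K} (h : Forces T φ x S) {Q : ℕ} (hQ : Q ≠ 0)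
    (hfrob : ∀ (M : Type u) [Field M] [CompatibleRing M] [(constantsOn C).Structure M],
      ∀ W : Subring (K × M), IsPartialHom C W → ∃ f : K × M →+* K × M, ∀ y, f y = y ^ Q)
    (hSB : ∀ y ∈ S, y ^ Q ∈ B)
    (hpow : ∀ (M : Type u) [Field M] [CompatibleRing M] [(constantsOn C).Structure M], T.Model M →
      ∀ W : Subring (K × M), IsPartialHom C W → (∀ y ∈ B, ∃ y', (y, y') ∈ W) →
        ∀ y ∈ S, ∀ y', (y ^ Q, y') ∈ W → ∃ z, y' = z ^ Q) : Forces T φ x B :=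
  fun M _ _ _ hM W hW hB x' hx' => by
    obtain ⟨f, hf⟩ := hfrob M W hW
    -- Pulling W back along y ↦ y ^ Q amounts to taking Q-th roots on both sides of the graph. The
    -- result still maps x to x', and it is defined on S because the powers of S are sent to Q-th
    -- powers.
    have hmem : ∀ y : K × M, y ∈ W.comap f ↔ y ^ Q ∈ W := fun y => by rw [Subring.mem_comap, hf]
    refine h M hM (W.comap f) ⟨fun c => (hmem _).2 (W.pow_mem (hW.const c) _), fun y hy => ?_⟩
      (fun y hy => ?_) x' fun i => (hmem _).2 (W.pow_mem (hx' i) _)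
    · rw [hmem, Prod.pow_mk, zero_pow hQ] at hy
      exact eq_zero_of_pow_eq_zero (hW.unique _ hy)
    · obtain ⟨y', hy'⟩ := hB _ (hSB y hy)
      obtain ⟨z, rfl⟩ := hpow M hM W hW hB y hy y' hy'
      exact ⟨z, (hmem _).2 hy'⟩

/-- Replacing S by suitable powers makes all generators separable except one auxiliary element z,
and such a field lies in a simple extension. -/
theorem Forces.exists_adjoin
    (hpowers : ∀ p : ℕ, p.Prime → ∀ n m : ℕ, 1 ≤ n → 1 ≤ m →
      existentialRank (withChar T p) (powersFormula C n (p ^ m)) ≤ 1)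
    (hK : T.Model K) (F : Subfield K) (hF : ∀ c : C, constVal K c ∈ F)
    {S : Finset K} (hS : ∀ y ∈ S, IsAlgebraic F y) (h : Forces T φ x S) :
    ∃ v : K, IsAlgebraic F v ∧ Forces T φ x F⟮v⟯ := by
  classical
  suffices h : ∃ Q : ℕ, (∀ y ∈ S, IsSeparable F (y ^ Q)) ∧ ∃ z : K, IsAlgebraic F z ∧
      Forces T φ x (adjoin F (insert z ((· ^ Q) '' (S : Set K)))) by
    obtain ⟨Q, hsep, z, hz, hφ⟩ := h
    obtain ⟨v, hv, hle⟩ := exists_adjoin_insert_le (S.finite_toSet.image (· ^ Q))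
      (by rintro _ ⟨y, hy, rfl⟩; exact hsep y hy) hz
    exact ⟨v, hv, hφ.mono hle⟩
  obtain ⟨p, hp⟩ := CharP.exists K
  rcases CharP.char_is_prime_or_zero K p with hpp | rfl
  · have : Fact p.Prime := ⟨hpp⟩
    have : ExpChar K p := .prime hpp
    have : ExpChar F p := (algebraMap F K).expChar (algebraMap F K).injective p
    obtain ⟨m, hm, hsep⟩ := exists_isSeparable_pow p hS
    have hpK : (p : K) = 0 := CharP.cast_eq_zero K p
    have hfrob : ∀ (M : Type u) [Field M] [CompatibleRing M] [(constantsOn C).Structure M],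
        ∀ W : Subring (K × M), IsPartialHom C W →
          ∃ f : K × M →+* K × M, ∀ y, f y = y ^ p ^ m := fun M _ _ _ W hW => by
      have : CharP M p := (CharP.charP_iff_prime_eq_zero hpp).2 (hW.natCast_eq_zero hpK)
      exact ⟨(iterateFrobenius K p m).prodMap (iterateFrobenius M p m), fun y => rfl⟩
    have hQ : p ^ m ≠ 0 := pow_ne_zero _ hpp.ne_zero
    refine ⟨p ^ m, hsep, ?_⟩
    -- The hypothesis on powers concerns nonempty tuples only.
    rcases S.eq_empty_or_nonempty with rfl | hne
    · exact ⟨0, isAlgebraic_zero, h.mono (by simp)⟩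
    let e := S.equivFin
    let β : Fin S.card → K := fun i => (e.symm i : K) ^ p ^ m
    have hβ : Set.range β = (· ^ p ^ m) '' (S : Set K) := by
      ext y
      constructor
      · rintro ⟨i, rfl⟩
        exact ⟨_, (e.symm i).2, rfl⟩
      · rintro ⟨y, hy, rfl⟩
        exact ⟨e ⟨y, hy⟩, by simp [β]⟩
    obtain ⟨z, hz, hzW⟩ := exists_isAlgebraic_forall_pow hpp
      (hpowers p hpp S.card m hne.card_pos hm) hK hpK F hF β
      (fun i => (hS _ (e.symm i).2).pow _) fun i => ⟨_, rfl⟩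
    rw [hβ] at hzW
    refine ⟨z, hz, h.of_pow hQ hfrob
      (fun y hy => subset_adjoin _ _ (Set.mem_insert_of_mem _ ⟨y, hy, rfl⟩)) ?_⟩
    intro M _ _ _ hM W hW hB y hy y' hy'
    have hβW : ∀ i, ∃ b, (β i, b) ∈ W := fun i => hB _ (subset_adjoin _ _
      (Set.mem_insert_of_mem _ (hβ ▸ Set.mem_range_self i)))
    choose b hb using hβW
    obtain ⟨w, hw⟩ := hzW M hM W hW hB b hb (e ⟨y, hy⟩)
    refine ⟨w, (hW.eq hy' ?_).trans hw⟩
    simpa [β] using hb (e ⟨y, hy⟩)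
  · have : CharZero K := CharP.charP_to_charZero K
    have : CharZero F := (algebraMap F K).charZero
    refine ⟨1, fun y hy => ?_, 0, isAlgebraic_zero, h.mono fun y hy =>
      subset_adjoin _ _ (Set.mem_insert_of_mem _ ⟨y, hy, pow_one y⟩)⟩
    rw [pow_one]
    exact (minpoly.irreducible (hS y hy).isIntegral).separable

/-- A subextension of transcendence degree at most `d` forcing `φ(x)` can be replaced by a set with
at most `d + 1` elements. -/
theorem Forces.exists_finset_card_le (hT : fieldsTheory C ⊆ T)
    (hpowers : ∀ p : ℕ, p.Prime → ∀ n m : ℕ, 1 ≤ n → 1 ≤ m →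
      existentialRank (withChar T p) (powersFormula C n (p ^ m)) ≤ 1)
    (hK : T.Model K) (K' : IntermediateField (baseField C K x) K) {d : ℕ}
    (hd : Algebra.trdeg (baseField C K x) K' ≤ d) (h : Forces T φ x K') :
    ∃ s : Finset K, s.card ≤ d + 1 ∧ Forces T φ x s := by
  classical
  obtain ⟨S, hS, hSφ⟩ := h.exists_finset hT
  obtain ⟨t, ht, halg⟩ := exists_subset_isAlgebraic_card_le K' hd S hS
  set F := Subfield.closure ((baseField C K x : Set K) ∪ t) with hFdef
  have hF : F = Subfield.closure
      ((t : Set K) ∪ (Set.range (constVal (C := C) K) ∪ Set.range x)) := by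
    rw [hFdef, Subfield.closure_union, Subfield.closure_eq, Subfield.closure_union, sup_comm]
    rfl
  obtain ⟨v, hv, hvφ⟩ := hSφ.exists_adjoin hpowers hK F
    (fun c => hF ▸ Subfield.subset_closure (Or.inr (Or.inl ⟨c, rfl⟩))) halg
  -- Compactness is needed a second time: the whole field F(v) need not be generated as a ring by
  -- one element over the generators of F, but finitely many of its elements can be captured.
  obtain ⟨S₁, hS₁, hS₁φ⟩ := hvφ.exists_finset hT
  obtain ⟨v', hv'⟩ := exists_forall_mem_closure_insert hF hv S₁ hS₁
  refine ⟨insert v' t, (Finset.card_insert_le _ _).trans (by lia), hS₁φ.of_subset_closure ?_⟩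
  rw [Finset.coe_insert, Set.insert_union]
  exact hv'

end FewElements

/-! ### The essential fibre dimension and ranks -/

section Main

universe u

open IntermediateField

variable {C : Type u} {T : (ringLang C).Theory} {n : ℕ} {φ : (ringLang C).Formula (Fin n)} {d : ℕ}

/-- A partial homomorphism defined on the field K' restricts to a ring homomorphism on K', so
preservation under embeddings already gives forcing. -/
theorem HasFibreDimLE.exists_forces (h : HasFibreDimLE T φ d) {K : Type u} [Field K]
    [CompatibleRing K] [(constantsOn C).Structure K] (hK : T.Model K) {x : Fin n → K}
    (hx : φ.Realize x) :
    ∃ K' : IntermediateField (baseField C K x) K,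
      Algebra.trdeg (baseField C K x) K' ≤ (d : Cardinal) ∧ Forces T φ x K' := by
  obtain ⟨K', hd, hK'⟩ := h K hK x hx
  refine ⟨K', hd, fun M _ _ _ hM W hW hdom x' hx' => ?_⟩
  obtain ⟨ρ, hρ⟩ := hW.exists_ringHom (algebraMap K' K) fun y => hdom y y.2
  convert hK' M hM ρ fun c => hW.eq (hρ _) (hW.const c) using 2 with i
  exact hW.eq (hx' i) (hρ (algebraMap (baseField C K x) K' (baseField.elem x i)))

theorem hasFibreDimLE_of_exists
    (h : ∀ (K : Type u) [Field K] [CompatibleRing K] [(constantsOn C).Structure K], T.Model K →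
      ∀ x : Fin n → K, φ.Realize x → ∃ K' : IntermediateField (baseField C K x) K,
        Algebra.trdeg (baseField C K x) K' ≤ (d : Cardinal) ∧
        ∀ (M : Type u) [Field M] [CompatibleRing M] [(constantsOn C).Structure M], T.Model M →
          ∀ ρ : K' →+* M, IsPartialHom C ((algebraMap K' K).prod ρ).range →
            φ.Realize fun i => ρ (algebraMap (baseField C K x) K' (baseField.elem x i))) :
    HasFibreDimLE T φ d := fun K _ _ _ hK x hx => by
  obtain ⟨K', hd, hK'⟩ := h K hK x hx
  refine ⟨K', hd, fun M _ _ _ hM ρ hρ => hK' M hM ρ ?_⟩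
  refine isPartialHom_range _ ρ (fun r hr => ?_) fun c => ⟨_, rfl, hρ c⟩
  rw [(map_eq_zero_iff _ (algebraMap K' K).injective).1 hr, map_zero]

/-- An independent family in k(s) lies in the matroid closure of s, so the rank of s bounds its
size. -/
theorem trdeg_adjoin_le_of_eRk_le {k K : Type u} [Field k] [Field K] [Algebra k K] {s : Set K}
    (hs : (AlgebraicIndependent.matroid k K).eRk s ≤ d) : Algebra.trdeg k (adjoin k s) ≤ d := by
  refine ciSup_le' fun ⟨u, hu⟩ => ?_
  have hind : AlgebraicIndependent k (fun y : u => (y : K)) :=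
    hu.map' (f := (adjoin k s).val) Subtype.val_injective
  have hI : (AlgebraicIndependent.matroid k K).Indep (Set.range fun y : u => (y : K)) :=
    hind.to_subtype_range
  have hcl : (Set.range fun y : u => (y : K)) ⊆ (AlgebraicIndependent.matroid k K).closure s := by
    rintro _ ⟨y, rfl⟩
    rw [AlgebraicIndependent.matroid_closure_eq]
    exact isAlgebraic_adjoin_iff.1 (isAlgebraic_algebraMap (y : adjoin k s))
  have := (hI.encard_le_eRk_of_subset hcl).trans ((Matroid.eRk_closure_eq _ _).trans_le hs)
  rw [Set.encard, ENat.card, Cardinal.toENat_le_natCast,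
    Cardinal.mk_range_eq _ hind.injective] at this
  exact this

theorem trdeg_adjoin_le {k K : Type u} [Field k] [Field K] [Algebra k K] (s : Finset K) :
    Algebra.trdeg k (adjoin k (s : Set K)) ≤ s.card :=
  trdeg_adjoin_le_of_eRk_le ((Matroid.eRk_le_encard _ _).trans (by simp))

theorem trdeg_adjoin_le_pred {k K : Type u} [Field k] [Field K] [Algebra k K] (s : Finset K)
    (hs : ¬ AlgebraicIndependent k ((↑) : s → K)) :
    Algebra.trdeg k (adjoin k (s : Set K)) ≤ (s.card - 1 : ℕ) := by
  refine trdeg_adjoin_le_of_eRk_le ?_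
  obtain ⟨t, ht⟩ := (AlgebraicIndependent.matroid k K).exists_isBasis (s : Set K)
  lift t to Finset K using s.finite_toSet.subset ht.subset
  have hlt : t.card < s.card := Finset.card_lt_card (by
    refine Finset.ssubset_iff_subset_ne.2 ⟨by exact_mod_cast ht.subset, ?_⟩
    rintro rfl
    exact hs ht.indep)
  rw [ht.eRk_eq_encard, Set.encard_coe_eq_coe_finsetCard]
  exact_mod_cast Nat.le_sub_one_of_lt hlt

/-- Adjoining the witnesses is enough: embeddings are injective, so they also preserve the required
inequations. -/
theorem IsExistentialWith.hasFibreDimLE {m : ℕ} (hφ : IsExistentialWith m φ) :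
    HasFibreDimLE T φ m := hasFibreDimLE_of_exists fun K _ _ _ hK x hx => by
  obtain ⟨s, D, hs, hD0, hsD⟩ := hφ.exists_finset hx
  refine ⟨adjoin _ (s : Set K), (trdeg_adjoin_le s).trans (by exact_mod_cast hs),
    fun M _ _ _ hM ρ hρ => hsD M _ hρ (fun y hy => ?_) (fun y hy hy0 => ?_) _ _ (fun i => ?_)
      fun i => i.elim0⟩
  · exact ⟨_, ⟨⟨y, subset_adjoin _ _ hy⟩, rfl⟩⟩
  · obtain ⟨r, hr⟩ := hy0
    simp only [RingHom.prod_apply, Prod.mk.injEq] at hr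
    rw [(map_eq_zero_iff _ ρ.injective).1 hr.2, map_zero] at hr
    exact hD0 (hr.1 ▸ hy)
  · exact ⟨algebraMap (baseField C K x) _ (baseField.elem x i), rfl⟩

theorem hasFibreDimLE_of_iff_isPosExistentialWith {m : ℕ}
    {ψ : (ringLang C).Formula (Fin n)} (hψ : IsPosExistentialWith m ψ) (h : T.Iff φ ψ) :
    HasFibreDimLE T φ (m - 1) := hasFibreDimLE_of_exists fun K _ _ _ hK x hx => by
  classical
  obtain ⟨s, hs, hsψ⟩ := hψ.exists_finset (h.realize_iff.1 hx)
  by_cases hind : AlgebraicIndependent (baseField C K x) ((↑) : s → K)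
  · refine ⟨⊥, ?_, fun M _ _ _ hM ρ hρ => h.realize_iff.2 ?_⟩
    · have : Algebra.IsAlgebraic (baseField C K x) (⊥ : IntermediateField (baseField C K x) K) :=
        inferInstance
      rw [trdeg_eq_zero]
      exact zero_le
    · let f : MvPolynomial s (baseField C K x) →+* K :=
        (MvPolynomial.aeval ((↑) : s → K) : _ →ₐ[baseField C K x] K).toRingHom
      -- Independent witnesses are all sent to 0; this map is usually not injective, hence
      -- positivity is essential.
      let g : MvPolynomial s (baseField C K x) →+* M :=
        MvPolynomial.eval₂Hom (ρ.comp (algebraMap (baseField C K x) _)) 0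
      have hf : Function.Injective f := hind
      refine hsψ M (f.prod g).range (isPartialHom_range f g (fun r hr => ?_) fun c => ?_)
        (fun y hy => ?_) _ _ (fun i => ?_) fun i => i.elim0
      · rw [(map_eq_zero_iff f hf).1 hr, map_zero]
      · refine ⟨.C (baseField.const x c), by simp [f]; rfl, ?_⟩
        simp only [g, MvPolynomial.coe_eval₂Hom, MvPolynomial.eval₂_C, RingHom.comp_apply]
        exact hρ.eq ⟨_, rfl⟩ (hρ.const c)
      · exact ⟨0, .X ⟨y, hy⟩, by simp [f, g]⟩
      · exact ⟨.C (baseField.elem x i), by simp [f, g]; rfl⟩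
  -- Dependence saves one in the transcendence degree. It also excludes empty s, so the truncated
  -- subtraction is harmless.
  · refine ⟨adjoin _ (s : Set K), (trdeg_adjoin_le_pred s hind).trans
      (by exact_mod_cast Nat.sub_le_sub_right hs 1), fun M _ _ _ hM ρ hρ => h.realize_iff.2 ?_⟩
    exact hsψ M _ hρ (fun y hy => ⟨_, ⟨⟨y, subset_adjoin _ _ hy⟩, rfl⟩⟩) _ _
      (fun i => ⟨algebraMap (baseField C K x) _ (baseField.elem x i), rfl⟩) fun i => i.elim0

theorem HasFibreDimLE.posExistentialRank_le (hT : fieldsTheory C ⊆ T)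
    (hpowers : ∀ p : ℕ, p.Prime → ∀ n m : ℕ, 1 ≤ n → 1 ≤ m →
      existentialRank (withChar T p) (powersFormula C n (p ^ m)) ≤ 1)
    (h : HasFibreDimLE T φ d) : posExistentialRank T φ ≤ (d + 1 : ℕ) := by
  obtain ⟨ψ, hψ, hiff⟩ := exists_isPosExistentialWith_iff (φ := φ) (d := d + 1) hT
    fun K _ _ _ hK x hx => by
      obtain ⟨K', hd, hK'⟩ := h.exists_forces hK hx
      exact hK'.exists_finset_card_le hT hpowers hK K' hd
  exact iInf₂_le _ ⟨ψ, hψ, hiff⟩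

theorem essFibreDim_eq (hT : fieldsTheory C ⊆ T)
    (hpowers : ∀ p : ℕ, p.Prime → ∀ n m : ℕ, 1 ≤ n → 1 ≤ m →
      existentialRank (withChar T p) (powersFormula C n (p ^ m)) ≤ 1)
    (hφ : IsExistentialFormula φ) :
    essFibreDim T φ < ⊤ ∧ essFibreDim T φ = max (posExistentialRank T φ - 1) 0 := by
  obtain ⟨m, hm⟩ := hφ
  have hfin : essFibreDim T φ ≤ m := iInf₂_le m hm.hasFibreDimLE
  refine ⟨hfin.trans_lt (ENat.natCast_lt_top m), ?_⟩
  rw [max_eq_left zero_le]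
  apply le_antisymm
  · have hlt : posExistentialRank T φ < ⊤ :=
      (hm.hasFibreDimLE.posExistentialRank_le hT hpowers).trans_lt (ENat.natCast_lt_top _)
    -- A finite infimum of natural numbers is attained, which yields a formula realizing the rank.
    obtain ⟨r, hr, ψ, hψ, hiff⟩ : ∃ r : ℕ, posExistentialRank T φ = r ∧
        ∃ ψ : (ringLang C).Formula (Fin n), IsPosExistentialWith r ψ ∧ T.Iff φ ψ := by
      obtain ⟨r, hr⟩ := ENat.ne_top_iff_exists.1 hlt.ne
      have hlt' : posExistentialRank T φ < (r + 1 : ℕ) := by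
        rw [← hr]
        exact ENat.natCast_lt_natCast.2 r.lt_succ_self
      simp only [posExistentialRank, iInf_lt_iff] at hlt'
      obtain ⟨r', hr', hlt'⟩ := hlt'
      have hle : (r : ℕ∞) ≤ r' := hr ▸ iInf₂_le r' hr'
      obtain rfl : r = r' := by
        have h₁ := ENat.natCast_lt_natCast.1 hlt'
        have h₂ := ENat.natCast_le_natCast.1 hle
        lia
      exact ⟨r, hr.symm, hr'⟩
    rw [hr]
    exact iInf₂_le (r - 1) (hasFibreDimLE_of_iff_isPosExistentialWith hψ hiff)
  · refine le_iInf₂ fun d hd => tsub_le_iff_right.2 ?_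
    exact_mod_cast hd.posExistentialRank_le hT hpowers

end Main

end ExistentialRank

end

theorem mainTheorem12 {C : Type*} (T : (ExistentialRank.ringLang C).Theory)
    (hfields : ExistentialRank.fieldsTheory C ⊆ T)
    (hpowers : ∀ p : ℕ, p.Prime → ∀ n m : ℕ, 1 ≤ n → 1 ≤ m →
      ExistentialRank.existentialRank (ExistentialRank.withChar T p)
        (ExistentialRank.powersFormula C n (p ^ m)) ≤ 1)
    {n : ℕ} (φ : (ExistentialRank.ringLang C).Formula (Fin n))
    (hφ : ExistentialRank.IsExistentialFormula φ) :
    ExistentialRank.essFibreDim T φ < ⊤ ∧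
      ExistentialRank.essFibreDim T φ =
        max (ExistentialRank.posExistentialRank T φ - 1) 0 :=
  ExistentialRank.essFibreDim_eq hfields hpowers hφ
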